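/- Let $D\ge 2$. For a unit vector $v$ write $\pi(v)=|v\rangle\langle v|$; $\|A\|_1=\mathrm{tr}\sqrt{A^\dagger A}$ is the trace norm. States are positive semidefinite $D\times D$ matrices of trace one. In a prepare-and-measure scenario with preparations $x$, measurements $y$ and outcomes $b$, a $D$-dimensional realization $(\bar\psi,\bar M)$ of $P$ consists of states $\bar\psi_x$ and POVMs $(\bar M_{b|y})_b$ on $\mathbb C^D$ with $P(b|x,y)=\mathrm{tr}(\bar\psi_x\bar M_{b|y})$; $Q_D$ is the set of all $P$ that have such a realization. Let $\psi_1,\dots,\psi_M$ be a finite family of pure states (unit vectors) in $\mathbb C^D$. For an orthonormal basis $|1\rangle,\dots,|D\rangle$ of $\mathbb C^D$ (the computational basis transformed by a unitary) let $\mathcal T$ be the $5D-6$ pure states $$|k\rangle,\quad \tfrac{|k\rangle+|k+1\rangle}{\sqrt2},\quad \tfrac{|k\rangle+i|k+1\rangle}{\sqrt2},\quad \tfrac{|k\rangle+|k+1\rangle+|k+2\rangle}{\sqrt3},\quad \tfrac{i|k\rangle+|k+1\rangle+i|k+2\rangle}{\sqrt3}$$ ($k$ ranging over $1..D$, $1..D-1$,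 $1..D-1$, $1..D-2$, $1..D-2$ respectively). (1) There is an orthonormal basis with $\langle k|\psi_i\rangle\neq0$ for all $i,k$. For every orthonormal basis there are at most $D-1$ pure states $\mathcal R$ and positive numbers $(\alpha_j)_{j=1}^N$ such that the ensemble $\Psi=(\Psi_j)_{j=1}^N:=\psi\cup\mathcal T\cup\mathcal R$ satisfies $\sum_j\alpha_j\pi(\Psi_j)=\mathbb I/D$. (2) Let the basis satisfy $\langle k|\psi_i\rangle\ne0$ for all $i,k$, and let $\mathcal R$ be any finite family of pure states and $\alpha_j>0$ any numbers with $\sum_j\alpha_j\pi(\Psi_j)=\mathbb I/D$. In the scenario with $N$ preparations and two-outcome measurements labelled by the pairs $(i,j)$, $i>j$, consider the linear witness $$W(P)=\sum_{i>j}\alpha_i\alpha_j\|\pi(\Psi_i)-\pi(\Psi_j)\|_1\bigl(P(2|i,(i,j))-P(2|j,(i,j))\bigr).$$ Then $\max_{P\in Q_D}W(P)=1-\frac1D$, and $W$ self-tests the states of $\psi\cup\mathcal T$, in particular the original states $\psi_i$: for every realization of a maximizer, with preparations $\bar\psi$, there is a unitary or anti-unitary $U$ with $\bar\psi_x=U\pi(\Psi_x)U^\dagger$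 for all $x$ labelling elements of $\psi\cup\mathcal T$. (3) Robustness: for all $f,a>0$ there is a constant $C=C(D,f,a)$ such that, for all data as in (2) (with $M$ and $|\mathcal R|$ arbitrary) satisfying $|\langle k|\psi_i\rangle|^2\ge f$ for all $i,k$ and $\alpha_j\ge a$ for all $j$, for every $\epsilon\ge0$ and every realization, with preparations $\bar\psi$, of a $P\in Q_D$ with $W(P)\ge 1-\frac1D-\epsilon$, there is a unitary or anti-unitary $U$ with $$\|U\bar\psi_xU^\dagger-\pi(\Psi_x)\|_1\le C\,\epsilon^{1/16}$$ for all $x$ labelling elements of $\psi\cup\mathcal T$. If $D=2$, the bound $C\,\epsilon^{1/8}$ holds. -/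

import Mathlib

open scoped ComplexConjugate ComplexOrder

namespace SelfTest

noncomputable section

/-- The Hilbert space `ℂ^D`. -/
abbrev Ket (D : ℕ) : Type := EuclideanSpace ℂ (Fin D)

/-- The operators `B(ℂ^D)`, as matrices in the computational basis. -/
abbrev Op (D : ℕ) : Type := Matrix (Fin D) (Fin D) ℂ

/-- `|v⟩⟨v|`; for a unit vector `v` this is the pure state (rank-one projector) of `v`. -/
def proj {D : ℕ} (v : Ket D) : Op D := Matrix.of fun i j => v i * conj (v j)

/-- Density operators, pure or mixed. -/
def IsState {D : ℕ} (ρ : Op D) : Prop := ρ.PosSemidef ∧ ρ.trace = 1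

/-- Positive operator-valued measures with finitely many outcomes. -/
def IsPOVM {D : ℕ} {B : Type} [Fintype B] (E : B → Op D) : Prop :=
  (∀ b, (E b).PosSemidef) ∧ ∑ b, E b = 1

/-- The trace norm `tr √(Aᴴ A)`, i.e. the sum of the singular values of `A`. -/
def traceNorm {D : ℕ} (A : Op D) : ℝ :=
  ∑ i, Real.sqrt ((Matrix.isHermitian_conjTranspose_mul_self A).eigenvalues i)

/-- `Θ` is the action `A ↦ V A V†` on operators of a unitary operator `V = U`, or of an
anti-unitary operator `V = U ∘ K`, with `U` unitary and `K` the complex conjugation in the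
computational basis (every anti-unitary is of this form, and `(U K) A (U K)† = U Ā U†`). -/
def IsUnitaryOrAntiunitary {D : ℕ} (Θ : Op D → Op D) : Prop :=
  ∃ U ∈ Matrix.unitaryGroup (Fin D) ℂ,
    (∀ A, Θ A = U * A * U.conjTranspose) ∨
    (∀ A, Θ A = U * A.map (starRingEnd ℂ) * U.conjTranspose)

/-- `(ρ, E)` is a `D`-dimensional realization of the behaviour `P x y b = P(b | x, y)`: the `ρ x`
are states, the `E y` are POVMs, and `P(b | x, y) = tr(ρ_x E_{b|y})`. -/
structure IsRealization {D : ℕ} {X Y B : Type} [Fintype B]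
    (ρ : X → Op D) (E : Y → B → Op D) (P : X → Y → B → ℝ) : Prop where
  state : ∀ x, IsState (ρ x)
  povm : ∀ y, IsPOVM (E y)
  prob : ∀ x y b, (P x y b : ℂ) = (ρ x * E y b).trace

/-- The set `Q_D` of behaviours with a `D`-dimensional realization. -/
def behaviours (D : ℕ) (X Y B : Type) [Fintype B] : Set (X → Y → B → ℝ) :=
  {P | ∃ (ρ : X → Op D) (E : Y → B → Op D), IsRealization ρ E P}

/-- The linear functional `W` self-tests the states `ψ i` as the preparations with labels `s i`:
in every `D`-dimensional realization of a behaviour maximizing `W` over `Q_D`, these preparations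
are the states `ψ i` up to one common unitary or anti-unitary. -/
def SelfTestsStates {D : ℕ} {X Y B ι : Type} [Fintype B]
    (W : (X → Y → B → ℝ) →ₗ[ℝ] ℝ) (s : ι → X) (ψ : ι → Op D) : Prop :=
  ∀ (ρ : X → Op D) (E : Y → B → Op D) (P : X → Y → B → ℝ), IsRealization ρ E P →
    (∀ P' ∈ behaviours D X Y B, W P' ≤ W P) →
    ∃ Θ : Op D → Op D, IsUnitaryOrAntiunitary Θ ∧ ∀ i, ρ (s i) = Θ (ψ i)

/-- Quantitative robust self-testing of states: whenever a behaviour comes within `ε` of the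
maximum `Wmax`, the preparations of each of its realizations are, up to one common unitary or
anti-unitary, within `C ε^r` of the reference states in trace norm. -/
def RobustlySelfTestsStates {D : ℕ} {X Y B ι : Type} [Fintype B]
    (W : (X → Y → B → ℝ) →ₗ[ℝ] ℝ) (Wmax : ℝ) (s : ι → X) (ψ : ι → Op D) (C r : ℝ) : Prop :=
  ∀ ε : ℝ, 0 ≤ ε →
    ∀ (ρ : X → Op D) (E : Y → B → Op D) (P : X → Y → B → ℝ), IsRealization ρ E P →
      Wmax - ε ≤ W P →
      ∃ Θ : Op D → Op D, IsUnitaryOrAntiunitary Θ ∧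
        ∀ i, traceNorm (Θ (ρ (s i)) - ψ i) ≤ C * ε ^ r

/-- Measurement labels: the pairs `(i, j)` with `i > j`. -/
abbrev PairLabel (N : ℕ) : Type := {p : Fin N × Fin N // p.2 < p.1}

/-- The witness
`W_Ψ(P) = ∑_{i > j} α_i α_j ‖Ψ_i - Ψ_j‖₁ (P(2 | i, (i, j)) - P(2 | j, (i, j)))`.
The two outcomes `1, 2` are the elements `0, 1` of `Fin 2`. -/
def witness {D N : ℕ} (Ψ : Fin N → Ket D) (α : Fin N → ℝ) :
    (Fin N → PairLabel N → Fin 2 → ℝ) →ₗ[ℝ] ℝ where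
  toFun P := ∑ p : PairLabel N,
    α p.1.1 * α p.1.2 * traceNorm (proj (Ψ p.1.1) - proj (Ψ p.1.2)) *
      (P p.1.1 p 1 - P p.1.2 p 1)
  map_add' P P' := by
    simp only [Pi.add_apply, ← Finset.sum_add_distrib]
    exact Finset.sum_congr rfl fun p _ => by ring
  map_smul' c P := by
    simp only [Pi.smul_apply, smul_eq_mul, RingHom.id_apply, Finset.mul_sum]
    exact Finset.sum_congr rfl fun p _ => by ring

/-- `∑ α_i Ψ_i = 𝕀 / D` with all `α_i > 0`. -/
def ResolvesIdentity {D N : ℕ} (Ψ : Fin N → Ket D) (α : Fin N → ℝ) : Prop :=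
  (∀ i, 0 < α i) ∧ ∑ i, (α i : ℂ) • proj (Ψ i) = (1 / (D : ℂ)) • (1 : Op D)

/-- The number of fiducial states; see `fiducialCount_eq`. -/
abbrev fiducialCount (D : ℕ) : ℕ := D + (D - 1) + (D - 1) + (D - 2) + (D - 2)

theorem fiducialCount_eq {D : ℕ} (hD : 2 ≤ D) : fiducialCount D = 5 * D - 6 := by
  simp only [fiducialCount]; omega

/-- The fiducial set `𝒯` relative to the orthonormal basis `|1⟩, …, |D⟩` given by `e`:
`|k⟩`, `(|k⟩ + |k+1⟩)/√2`, `(|k⟩ + i|k+1⟩)/√2`, `(|k⟩ + |k+1⟩ + |k+2⟩)/√3` and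
`(i|k⟩ + |k+1⟩ + i|k+2⟩)/√3`, for all `k` for which they make sense. -/
def fiducial {D : ℕ} (e : OrthonormalBasis (Fin D) ℂ (Ket D)) : Fin (fiducialCount D) → Ket D :=
  Fin.append (Fin.append (Fin.append (Fin.append
    (fun k : Fin D => e k)
    (fun k : Fin (D - 1) =>
      (1 / ((Real.sqrt 2 : ℝ) : ℂ)) • (e ⟨k, by omega⟩ + e ⟨k + 1, by omega⟩)))
    (fun k : Fin (D - 1) =>
      (1 / ((Real.sqrt 2 : ℝ) : ℂ)) • (e ⟨k, by omega⟩ + Complex.I • e ⟨k + 1, by omega⟩)))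
    (fun k : Fin (D - 2) =>
      (1 / ((Real.sqrt 3 : ℝ) : ℂ)) •
        (e ⟨k, by omega⟩ + e ⟨k + 1, by omega⟩ + e ⟨k + 2, by omega⟩)))
    (fun k : Fin (D - 2) =>
      (1 / ((Real.sqrt 3 : ℝ) : ℂ)) •
        (Complex.I • e ⟨k, by omega⟩ + e ⟨k + 1, by omega⟩ + Complex.I • e ⟨k + 2, by omega⟩))

/-- The family `ψ ∪ 𝒯` of tested states: first the `ψ i`, then the fiducial states. -/
def tested {D M : ℕ} (ψ : Fin M → Ket D) (e : OrthonormalBasis (Fin D) ℂ (Ket D)) :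
    Fin (M + fiducialCount D) → Ket D :=
  Fin.append ψ (fiducial e)

/-- The family `ψ ∪ 𝒯 ∪ ℛ` entering the witness. -/
def extended {D M K : ℕ} (ψ : Fin M → Ket D) (e : OrthonormalBasis (Fin D) ℂ (Ket D))
    (R : Fin K → Ket D) : Fin (M + fiducialCount D + K) → Ket D :=
  Fin.append (tested ψ e) R

end

end SelfTest

/-!
The witness is chosen so that two elementary inequalities bound it. For an effect `E`, the advantage
`t = tr((ρ_i - ρ_j) E)` in discriminating two states satisfies `t ≤ s := √(1 - tr ρ_i ρ_j)`
(`sq_trace_sub_mul_le`), while the trace norm of the difference of the reference states is `2 a`,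
`a := √(1 - |⟨Ψ_i, Ψ_j⟩|²)` (`traceNorm_proj_sub_proj`). Writing `2 a s = a² + s² - (a - s)²`, the
sum over all pairs of `a²` is fixed by the resolution of the identity, and that of `s²` is bounded by
the fact that the mean state has purity at least `1 / D`. So the maximum is `1 - 1 / D`, it is
attained by the reference states with the measurements discriminating them optimally, and a
realization within `ε` of the maximum satisfies `|a - s| = O(√ε)` for every pair and has almost pure
states (`witness_add_deficit_le`, `abs_trace_sub_overlap_le`): all pairwise overlaps of the
preparations are within `O(√ε)` of those of the reference states.

It remains to see that these overlaps determine the states (`exists_rigidity`). The preparations are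
replaced by nearby pure states. Those corresponding to the basis are almost orthonormal, hence close
to the columns of a unitary, the polar factor of the matrix they form; in these coordinates all
populations are right up to `O(ε^(1/4))`. After a choice of phases the states `(|k⟩ + |k+1⟩)/√2` are
right as well, so the overlaps with them give the real parts of the coherences between the levels `k`
and `k+1` of all other states. The states `(|k⟩ + i|k+1⟩)/√2` then give the imaginary parts, up to a
sign depending on `k` only (`exists_sign_coherence`). The remaining fiducial states force these signs
to agree (`sign_eq_sign_of_overlap`): their overlap is `5/9` or `1/9` according to the relative sign.
A global sign is a complex conjugation, which is why anti-unitaries occur. Finally the identity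
`Z_{ab} Z_{bd} = Z_{bb} Z_{ad}` for rank-one `Z` propagates the coherences from neighbouring levels to
all pairs of levels (`norm_proj_sub_le_of_adjacent`); this is where the overlaps of the states with
the basis have to be bounded below. Only the passage from squared overlaps to populations costs a
square root, so the final error is of order `ε^(1/4)`, which is better than required. Exact
self-testing is the case `ε = 0`.

An adapted basis is a generic real Householder reflection of the computational one
(`exists_basis_inner_ne_zero`), and the completion states are eigenvectors of `∑ Ψ_i`
(`exists_completion`).
-/

namespace SelfTest

/-! ### Frobenius norm and trace norm -/

section Frobenius

open scoped Matrix.Norms.Frobenius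

variable {D : ℕ}

theorem frobenius_sq_eq_sum (A : Op D) : ‖A‖ ^ 2 = ∑ i, ∑ j, ‖A i j‖ ^ 2 := by
  rw [Matrix.frobenius_norm_def, ← Real.sqrt_eq_rpow, Real.sq_sqrt (by positivity)]
  simp

theorem frobenius_sq_eq_trace (A : Op D) : ‖A‖ ^ 2 = (A.conjTranspose * A).trace.re := by
  rw [frobenius_sq_eq_sum, Finset.sum_comm]
  simp only [Matrix.trace, Matrix.diag, Matrix.mul_apply, Matrix.conjTranspose_apply,
    Complex.re_sum]
  refine Finset.sum_congr rfl fun i _ => Finset.sum_congr rfl fun j _ => ?_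
  rw [← Complex.normSq_eq_norm_sq, Complex.normSq_apply]
  simp

theorem norm_entry_le_frobenius (A : Op D) (i j : Fin D) : ‖A i j‖ ≤ ‖A‖ := by
  refine abs_le_of_sq_le_sq' ?_ (norm_nonneg _) |>.2
  rw [frobenius_sq_eq_sum]
  exact (Finset.single_le_sum (f := fun j => ‖A i j‖ ^ 2) (fun _ _ => by positivity)
    (Finset.mem_univ j)).trans (Finset.single_le_sum (f := fun i => ∑ j, ‖A i j‖ ^ 2)
      (fun _ _ => by positivity) (Finset.mem_univ i))

theorem frobenius_le_of_entry_le {A : Op D} {c : ℝ} (hc : 0 ≤ c) (h : ∀ i j, ‖A i j‖ ≤ c) :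
    ‖A‖ ≤ D * c := by
  refine abs_le_of_sq_le_sq' ?_ (by positivity) |>.2
  rw [frobenius_sq_eq_sum]
  calc ∑ i, ∑ j, ‖A i j‖ ^ 2 ≤ ∑ _i : Fin D, ∑ _j : Fin D, c ^ 2 := by
        gcongr with i _ j _; exact h i j
    _ = (D * c) ^ 2 := by simp; ring

/-- The Cauchy–Schwarz inequality for the Hilbert–Schmidt inner product. -/
theorem norm_trace_mul_le (A B : Op D) : ‖(A * B).trace‖ ≤ ‖A‖ * ‖B‖ := by
  have h : (A * B).trace = ∑ p : Fin D × Fin D, A p.1 p.2 * B p.2 p.1 := by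
    simp [Matrix.trace, Matrix.mul_apply, Fintype.sum_prod_type]
  have hB : ‖B‖ ^ 2 = ∑ p : Fin D × Fin D, ‖B p.2 p.1‖ ^ 2 := by
    rw [frobenius_sq_eq_sum, Finset.sum_comm, Fintype.sum_prod_type]
  have hA : ‖A‖ ^ 2 = ∑ p : Fin D × Fin D, ‖A p.1 p.2‖ ^ 2 := by
    rw [frobenius_sq_eq_sum, Fintype.sum_prod_type]
  rw [h]
  refine (norm_sum_le _ _).trans ?_
  simp only [norm_mul]
  refine abs_le_of_sq_le_sq' ?_ (by positivity) |>.2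
  rw [mul_pow, hA, hB]
  exact Finset.sum_mul_sq_le_sq_mul_sq _ _ _

theorem frobenius_one_sq : ‖(1 : Op D)‖ ^ 2 = D := by
  rw [frobenius_sq_eq_trace]; simp

theorem frobenius_unitary_mul {U : Op D} (hU : U ∈ Matrix.unitaryGroup (Fin D) ℂ) (A : Op D) :
    ‖U * A‖ = ‖A‖ := by
  rw [← sq_eq_sq₀ (norm_nonneg _) (norm_nonneg _), frobenius_sq_eq_trace, frobenius_sq_eq_trace,
    Matrix.conjTranspose_mul, mul_assoc, ← mul_assoc _ U, ← Matrix.star_eq_conjTranspose U,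
    Matrix.mem_unitaryGroup_iff'.1 hU, one_mul]

theorem frobenius_mul_unitary {U : Op D} (hU : U ∈ Matrix.unitaryGroup (Fin D) ℂ) (A : Op D) :
    ‖A * U‖ = ‖A‖ := by
  rw [← Matrix.frobenius_norm_conjTranspose, Matrix.conjTranspose_mul,
    ← Matrix.star_eq_conjTranspose U, frobenius_unitary_mul (Unitary.star_mem hU),
    Matrix.frobenius_norm_conjTranspose]

theorem frobenius_conj_unitary {U : Op D} (hU : U ∈ Matrix.unitaryGroup (Fin D) ℂ)
    (A : Op D) : ‖U * A * U.conjTranspose‖ = ‖A‖ := by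
  rw [← Matrix.star_eq_conjTranspose, frobenius_mul_unitary (Unitary.star_mem hU),
    frobenius_unitary_mul hU]

theorem frobenius_map_conj (A : Op D) : ‖A.map (starRingEnd ℂ)‖ = ‖A‖ :=
  Matrix.frobenius_norm_map_eq _ _ fun a => by simp

theorem IsUnitaryOrAntiunitary.frobenius_sub {Θ : Op D → Op D} (h : IsUnitaryOrAntiunitary Θ)
    (A B : Op D) : ‖Θ A - Θ B‖ = ‖A - B‖ := by
  obtain ⟨U, hU, h | h⟩ := h
  · rw [h, h, ← Matrix.sub_mul, ← Matrix.mul_sub, frobenius_conj_unitary hU]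
  · have : A.map (starRingEnd ℂ) - B.map (starRingEnd ℂ) = (A - B).map (starRingEnd ℂ) := by
      ext; simp
    rw [h, h, ← Matrix.sub_mul, ← Matrix.mul_sub, this, frobenius_conj_unitary hU,
      frobenius_map_conj]

theorem traceNorm_le_frobenius (A : Op D) : traceNorm A ≤ D * ‖A‖ := by
  have hs := (Matrix.isHermitian_conjTranspose_mul_self A).trace_eq_sum_eigenvalues
  have h0 := (Matrix.posSemidef_conjTranspose_mul_self A).eigenvalues_nonneg
  have key : ∀ i, Real.sqrt ((Matrix.isHermitian_conjTranspose_mul_self A).eigenvalues i) ≤ ‖A‖ := by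
    intro i
    refine Real.sqrt_le_iff.2 ⟨norm_nonneg _, ?_⟩
    rw [frobenius_sq_eq_trace, hs, Complex.re_sum]
    exact Finset.single_le_sum (f := fun i =>
      ((Matrix.isHermitian_conjTranspose_mul_self A).eigenvalues i : ℂ).re)
      (fun i _ => by simpa using h0 i) (Finset.mem_univ i)
  calc traceNorm A ≤ ∑ _i : Fin D, ‖A‖ := Finset.sum_le_sum fun i _ => key i
    _ = D * ‖A‖ := by simp

theorem traceNorm_nonneg (A : Op D) : 0 ≤ traceNorm A :=
  Finset.sum_nonneg fun _ _ => Real.sqrt_nonneg _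

theorem traceNorm_eq_zero {A : Op D} (h : traceNorm A ≤ 0) : A = 0 := by
  have h0 := (Matrix.posSemidef_conjTranspose_mul_self A).eigenvalues_nonneg
  have h1 := (Finset.sum_eq_zero_iff_of_nonneg (fun i _ => Real.sqrt_nonneg _)).1
    (le_antisymm h (traceNorm_nonneg A))
  have h2 : (Matrix.isHermitian_conjTranspose_mul_self A).eigenvalues = 0 := by
    funext i
    exact (Real.sqrt_eq_zero (h0 i)).1 (h1 i (Finset.mem_univ i))
  have h3 := (Matrix.IsHermitian.eigenvalues_eq_zero_iff
    (Matrix.isHermitian_conjTranspose_mul_self A)).1 h2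
  have h4 : ‖A‖ ^ 2 = 0 := by rw [frobenius_sq_eq_trace, h3]; simp
  simpa using h4

/-- If `H = Aᴴ A` satisfies `H² = s² H`, all singular values of `A` are `0` or `s`, and
`s ‖A‖₁ = tr H`. -/
theorem mul_traceNorm_of_sq_eq {A : Op D} {s : ℝ} (hs : 0 ≤ s)
    (h : (A.conjTranspose * A) * (A.conjTranspose * A) = ((s ^ 2 : ℝ) : ℂ) • (A.conjTranspose * A)) :
    s * traceNorm A = (A.conjTranspose * A).trace.re ∧ (s = 0 → traceNorm A = 0) := by
  set hH := Matrix.isHermitian_conjTranspose_mul_self A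
  have h0 := (Matrix.posSemidef_conjTranspose_mul_self A).eigenvalues_nonneg
  have key : ∀ i, hH.eigenvalues i * hH.eigenvalues i = s ^ 2 * hH.eigenvalues i := by
    intro i
    have hv := hH.mulVec_eigenvectorBasis i
    have h1 := congrArg (fun M => M.mulVec (hH.eigenvectorBasis i).ofLp) h
    simp only [← Matrix.mulVec_mulVec, Matrix.smul_mulVec, hv, Matrix.mulVec_smul] at h1
    have hne : (hH.eigenvectorBasis i).ofLp ≠ 0 := by
      intro h2
      have := hH.eigenvectorBasis.orthonormal.ne_zero i
      apply this
      ext k; simp [h2]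
    obtain ⟨k, hk⟩ := Function.ne_iff.1 hne
    have h3 := congrFun h1 k
    simp only [Pi.smul_apply, Complex.real_smul, smul_eq_mul, Pi.zero_apply, ← mul_assoc] at h3 hk
    have h4 := mul_right_cancel₀ hk h3
    exact_mod_cast h4
  have hsq : ∀ i, s * Real.sqrt (hH.eigenvalues i) = hH.eigenvalues i := by
    intro i
    rcases eq_or_ne (hH.eigenvalues i) 0 with h1 | h1
    · simp [h1]
    · have h2 := mul_right_cancel₀ h1 (key i)
      rw [h2, Real.sqrt_sq hs]; ring
  constructor
  · rw [hH.trace_eq_sum_eigenvalues, traceNorm, Finset.mul_sum, Complex.re_sum]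
    exact Finset.sum_congr rfl fun i _ => by simpa using hsq i
  · intro h1
    refine Finset.sum_eq_zero fun i _ => ?_
    have h2 := hsq i
    rw [h1, zero_mul] at h2
    rw [← h2]; simp

end Frobenius

/-! ### Pure states -/

section Pure

open scoped Matrix.Norms.Frobenius

variable {D : ℕ}

theorem proj_eq_vecMulVec (v : Ket D) : proj v = Matrix.vecMulVec v.ofLp (star v.ofLp) := by
  ext i j; simp [proj, Matrix.vecMulVec_apply]

theorem proj_posSemidef (v : Ket D) : (proj v).PosSemidef := by
  rw [proj_eq_vecMulVec]; exact Matrix.posSemidef_vecMulVec_self_star _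

theorem proj_conjTranspose (v : Ket D) : (proj v).conjTranspose = proj v :=
  (proj_posSemidef v).isHermitian

theorem inner_eq_sum (u v : Ket D) : inner ℂ u v = ∑ k, conj (u k) * v k := by
  simp [PiLp.inner_apply, mul_comm]

theorem sum_norm_sq_eq_one {v : Ket D} (hv : ‖v‖ = 1) : ∑ k, ‖v k‖ ^ 2 = 1 := by
  rw [← EuclideanSpace.norm_sq_eq, hv, one_pow]

theorem proj_mul_proj (u v : Ket D) :
    proj u * proj v = inner ℂ u v • Matrix.vecMulVec u.ofLp (star v.ofLp) := by
  rw [proj_eq_vecMulVec, proj_eq_vecMulVec, Matrix.vecMulVec_mul_vecMulVec, inner_eq_sum]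
  ext i j
  simp only [Matrix.smul_apply, Matrix.vecMulVec_apply, smul_eq_mul, Pi.smul_apply, dotProduct,
    Pi.star_apply, RCLike.star_def]
  ring

theorem trace_proj (v : Ket D) (hv : ‖v‖ = 1) : (proj v).trace = 1 := by
  have h := sum_norm_sq_eq_one hv
  simp only [Matrix.trace, Matrix.diag, proj, Matrix.of_apply, Complex.mul_conj']
  exact_mod_cast h

theorem isState_proj {v : Ket D} (hv : ‖v‖ = 1) : IsState (proj v) :=
  ⟨proj_posSemidef v, trace_proj v hv⟩

theorem trace_proj_mul (v : Ket D) (A : Op D) :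
    (proj v * A).trace = ∑ k, conj (v k) * (A.mulVec v.ofLp) k := by
  rw [Matrix.trace_mul_comm, proj_eq_vecMulVec, Matrix.mul_vecMulVec, Matrix.trace_vecMulVec]
  simp [dotProduct, mul_comm]

theorem trace_proj_mul_proj (u v : Ket D) :
    (proj u * proj v).trace = ((‖inner ℂ u v‖ ^ 2 : ℝ) : ℂ) := by
  rw [proj_mul_proj, Matrix.trace_smul, Matrix.trace_vecMulVec, smul_eq_mul]
  have : u.ofLp ⬝ᵥ star v.ofLp = conj (inner ℂ u v) := by
    rw [inner_eq_sum, map_sum]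
    simp [dotProduct]
  rw [this, Complex.mul_conj']
  push_cast; rfl

theorem proj_mul_self {v : Ket D} (hv : ‖v‖ = 1) : proj v * proj v = proj v := by
  rw [proj_mul_proj, inner_self_eq_norm_sq_to_K, hv, proj_eq_vecMulVec]; simp

theorem proj_mul_proj_mul_proj (u v : Ket D) :
    proj u * proj v * proj u = ((‖inner ℂ u v‖ ^ 2 : ℝ) : ℂ) • proj u := by
  have h : ((‖inner ℂ u v‖ ^ 2 : ℝ) : ℂ) = inner ℂ u v * inner ℂ v u := by
    rw [← inner_conj_symm v u, Complex.mul_conj']; push_cast; rfl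
  rw [h, proj_mul_proj, proj_eq_vecMulVec u, Matrix.smul_mul, Matrix.vecMulVec_mul_vecMulVec,
    inner_eq_sum v u]
  ext i j
  simp only [Matrix.smul_apply, Matrix.vecMulVec_apply, smul_eq_mul, Pi.smul_apply, dotProduct,
    Pi.star_apply, RCLike.star_def]
  ring

theorem norm_inner_sq_le_one {u v : Ket D} (hu : ‖u‖ = 1) (hv : ‖v‖ = 1) :
    ‖inner ℂ u v‖ ^ 2 ≤ 1 := by
  have h := norm_inner_le_norm (𝕜 := ℂ) u v
  rw [hu, hv, one_mul] at h
  exact pow_le_one₀ (norm_nonneg _) h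

/-- The difference `A` of two pure states has eigenvalues `0, ±s` with `s = √(1 - |⟨u, v⟩|²)`. -/
theorem proj_sub_proj_cube {u v : Ket D} (hu : ‖u‖ = 1) (hv : ‖v‖ = 1) :
    (proj u - proj v) * (proj u - proj v) * (proj u - proj v) =
      ((1 - ‖inner ℂ u v‖ ^ 2 : ℝ) : ℂ) • (proj u - proj v) := by
  have h1 := proj_mul_proj_mul_proj u v
  have h2 := proj_mul_proj_mul_proj v u
  rw [norm_inner_symm v u] at h2
  have h3 : (proj u - proj v) * (proj u - proj v) * (proj u - proj v) =
      proj u * proj u * proj u - proj u * proj u * proj v - proj u * proj v * proj u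
      + proj u * (proj v * proj v) - proj v * (proj u * proj u) + proj v * proj u * proj v
      + proj v * proj v * proj u - proj v * proj v * proj v := by noncomm_ring
  rw [h3, h1, h2, proj_mul_self hu, proj_mul_self hu, proj_mul_self hv, proj_mul_self hv]
  push_cast
  module

/-- The trace distance `√(1 - |⟨u, v⟩|²)` of two pure states, half the trace norm of their
difference; see `traceNorm_proj_sub_proj`. -/
noncomputable def pureGap (u v : Ket D) : ℝ := Real.sqrt (1 - ‖inner ℂ u v‖ ^ 2)

theorem pureGap_nonneg (u v : Ket D) : 0 ≤ pureGap u v := Real.sqrt_nonneg _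

theorem pureGap_sq {u v : Ket D} (hu : ‖u‖ = 1) (hv : ‖v‖ = 1) :
    pureGap u v ^ 2 = 1 - ‖inner ℂ u v‖ ^ 2 :=
  Real.sq_sqrt (sub_nonneg.2 (norm_inner_sq_le_one hu hv))

theorem pureGap_le_one (u v : Ket D) : pureGap u v ≤ 1 :=
  Real.sqrt_le_one.2 (by linarith [sq_nonneg ‖inner ℂ u v‖])

theorem trace_proj_sub_proj_sq {u v : Ket D} (hu : ‖u‖ = 1) (hv : ‖v‖ = 1) :
    ((proj u - proj v) * (proj u - proj v)).trace = ((2 * pureGap u v ^ 2 : ℝ) : ℂ) := by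
  have h3 : (proj u - proj v) * (proj u - proj v) =
      proj u * proj u - proj u * proj v - proj v * proj u + proj v * proj v := by noncomm_ring
  rw [h3, proj_mul_self hu, proj_mul_self hv, Matrix.trace_add, Matrix.trace_sub,
    Matrix.trace_sub, trace_proj_mul_proj, trace_proj_mul_proj, trace_proj u hu, trace_proj v hv,
    pureGap_sq hu hv, norm_inner_symm v u]
  push_cast; ring

theorem traceNorm_proj_sub_proj {u v : Ket D} (hu : ‖u‖ = 1) (hv : ‖v‖ = 1) :
    traceNorm (proj u - proj v) = 2 * pureGap u v := by
  have hA : (proj u - proj v).conjTranspose = proj u - proj v := by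
    rw [Matrix.conjTranspose_sub, proj_conjTranspose, proj_conjTranspose]
  have h := mul_traceNorm_of_sq_eq (A := proj u - proj v) (pureGap_nonneg u v) (by
    rw [hA, ← mul_assoc, proj_sub_proj_cube hu hv, pureGap_sq hu hv, Matrix.smul_mul])
  rw [hA, trace_proj_sub_proj_sq hu hv, Complex.ofReal_re] at h
  rcases eq_or_ne (pureGap u v) 0 with h0 | h0
  · rw [h.2 h0, h0, mul_zero]
  · exact mul_left_cancel₀ h0 (by linarith [h.1])

/-- The two-outcome measurement `(𝕀 ∓ A / s) / 2`, with the upper sign for the outcome `0`. It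
optimally discriminates two pure states with difference `A`, whose nonzero eigenvalues are `±s`. It
is not projective on the kernel of `A`, which does not matter. For equal states `s = 0`, and the
convention `0⁻¹ = 0` makes it the uninformative measurement. -/
noncomputable def helstrom (u v : Ket D) (b : Fin 2) : Op D :=
  (1 / 2 : ℂ) • (1 + ((if b = 1 then 1 else -1) * ((pureGap u v)⁻¹ : ℂ)) • (proj u - proj v))

/-- A Hermitian `B` with `B³ = B` satisfies `1 + B ≥ 0`. -/
theorem posSemidef_one_add_of_cube_eq {B : Op D} (hB : B.IsHermitian) (h : B * B * B = B) :
    (1 + B).PosSemidef := by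
  have e : 1 + B = (1 - B * B).conjTranspose * (1 - B * B) +
      (1 / 2 : ℝ) • ((B + B * B).conjTranspose * (B + B * B)) := by
    have h1 : (1 - B * B).conjTranspose = 1 - B * B := by
      simp [Matrix.conjTranspose_sub, Matrix.conjTranspose_mul, hB.eq]
    have h2 : (B + B * B).conjTranspose = B + B * B := by
      simp [Matrix.conjTranspose_add, Matrix.conjTranspose_mul, hB.eq]
    have h4 : B * (B * B) = B := by rw [← mul_assoc, h]
    have h5 : B * B * (B * B) = B * B := by rw [← mul_assoc, h]
    rw [h1, h2, sub_mul, mul_sub, mul_sub, one_mul, mul_one, one_mul, add_mul, mul_add, mul_add,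
      h4, h5, h]
    module
  rw [e]
  exact (Matrix.posSemidef_conjTranspose_mul_self _).add
    ((Matrix.posSemidef_conjTranspose_mul_self _).smul (by norm_num))

theorem isPOVM_helstrom {u v : Ket D} (hu : ‖u‖ = 1) (hv : ‖v‖ = 1) : IsPOVM (helstrom u v) := by
  constructor
  · intro b
    have h : ∀ t : ℝ, t = 1 ∨ t = -1 → ((1 / 2 : ℝ) • (1 + ((t * (pureGap u v)⁻¹ : ℝ) : ℂ) •
        (proj u - proj v))).PosSemidef := by
      intro t ht
      refine (posSemidef_one_add_of_cube_eq ?_ ?_).smul (by norm_num)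
      · rw [Matrix.IsHermitian, Matrix.conjTranspose_smul, Matrix.conjTranspose_sub,
          proj_conjTranspose, proj_conjTranspose]
        simp
      · simp only [Matrix.smul_mul, Matrix.mul_smul, smul_smul]
        rw [proj_sub_proj_cube hu hv, ← pureGap_sq hu hv, smul_smul]
        congr 1
        norm_cast
        rcases eq_or_ne (pureGap u v) 0 with h0 | h0
        · simp [h0]
        · have ht2 : t * t = 1 := by rcases ht with rfl | rfl <;> norm_num
          field_simp
          linear_combination t * ht2
    have := h (if b = 1 then 1 else -1) (by split_ifs <;> simp)
    convert! this using 1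
    ext i j
    simp only [helstrom, Matrix.smul_apply, Complex.real_smul, smul_eq_mul]
    push_cast
    split_ifs <;> simp
  · rw [Fin.sum_univ_two]
    simp only [helstrom]
    norm_num
    module

theorem trace_mul_helstrom {u v : Ket D} (hu : ‖u‖ = 1) (hv : ‖v‖ = 1) :
    ((proj u - proj v) * helstrom u v 1).trace = (pureGap u v : ℂ) := by
  simp only [helstrom, if_true, one_mul, Matrix.mul_smul, mul_add, mul_one, Matrix.trace_smul,
    Matrix.trace_add, Matrix.trace_sub, trace_proj u hu, trace_proj v hv,
    trace_proj_sub_proj_sq hu hv, smul_eq_mul]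
  rcases eq_or_ne (pureGap u v) 0 with h0 | h0
  · simp [h0]
  · have : (pureGap u v : ℂ) ≠ 0 := by exact_mod_cast h0
    push_cast
    field_simp
    ring

end Pure

/-! ### Discriminating two states -/

section Discrimination

open scoped Matrix.Norms.Frobenius

variable {D : ℕ}

theorem exists_conjTranspose_mul_self {A : Op D} (h : A.PosSemidef) :
    ∃ R : Op D, A = R.conjTranspose * R := by
  open scoped MatrixOrder in
  obtain ⟨R, hR⟩ := CStarAlgebra.nonneg_iff_eq_star_mul_self.mp h.nonneg
  exact ⟨R, hR⟩

theorem trace_mul_eq_frobenius_sq (R S : Op D) :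
    ((R.conjTranspose * R * (S.conjTranspose * S)).trace).re = ‖R * S.conjTranspose‖ ^ 2 := by
  rw [frobenius_sq_eq_trace, Matrix.conjTranspose_mul, Matrix.conjTranspose_conjTranspose]
  rw [← mul_assoc, Matrix.trace_mul_comm]
  simp only [mul_assoc]

/-- The advantage in discriminating two states by one effect is at most `√(1 - tr ρσ)`. With
`ρ = R† R`, `σ = S† S`, `E = F† F`, `1 - E = G† G`, the bound follows from
`R S† = (R F†) (F S†) + (R G†) (G S†)` and submultiplicativity of the Frobenius norm. -/
theorem sq_trace_sub_mul_le {ρ σ E : Op D} (hρ : IsState ρ) (hσ : IsState σ)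
    (hE : E.PosSemidef) (hE' : (1 - E).PosSemidef) :
    ((ρ * E).trace.re - (σ * E).trace.re) ^ 2 ≤ 1 - (ρ * σ).trace.re := by
  obtain ⟨R, hR⟩ := exists_conjTranspose_mul_self hρ.1
  obtain ⟨S, hS⟩ := exists_conjTranspose_mul_self hσ.1
  obtain ⟨F, hF⟩ := exists_conjTranspose_mul_self hE
  obtain ⟨G, hG⟩ := exists_conjTranspose_mul_self hE'
  have e1 : (ρ * E).trace.re + (ρ * (1 - E)).trace.re = 1 := by
    rw [← Complex.add_re, ← Matrix.trace_add, ← mul_add, add_sub_cancel, mul_one, hρ.2]; simp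
  have e2 : (σ * E).trace.re + (σ * (1 - E)).trace.re = 1 := by
    rw [← Complex.add_re, ← Matrix.trace_add, ← mul_add, add_sub_cancel, mul_one, hσ.2]; simp
  have h1 : (ρ * E).trace.re = ‖R * F.conjTranspose‖ ^ 2 := by
    rw [hR, hF, trace_mul_eq_frobenius_sq]
  have h2 : (ρ * (1 - E)).trace.re = ‖R * G.conjTranspose‖ ^ 2 := by
    rw [hR, hG, trace_mul_eq_frobenius_sq]
  have swap : ∀ A B : Op D, ‖A * B.conjTranspose‖ = ‖B * A.conjTranspose‖ := fun A B => by
    rw [← Matrix.frobenius_norm_conjTranspose, Matrix.conjTranspose_mul,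
      Matrix.conjTranspose_conjTranspose]
  have h3 : (σ * E).trace.re = ‖F * S.conjTranspose‖ ^ 2 := by
    rw [hS, hF, trace_mul_eq_frobenius_sq, swap]
  have h4 : (σ * (1 - E)).trace.re = ‖G * S.conjTranspose‖ ^ 2 := by
    rw [hS, hG, trace_mul_eq_frobenius_sq, swap]
  have h5 : (ρ * σ).trace.re = ‖R * S.conjTranspose‖ ^ 2 := by
    rw [hR, hS, trace_mul_eq_frobenius_sq]
  have h6 : R * S.conjTranspose = R * F.conjTranspose * (F * S.conjTranspose) +
      R * G.conjTranspose * (G * S.conjTranspose) := by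
    have : F.conjTranspose * F + G.conjTranspose * G = 1 := by rw [← hF, ← hG, add_sub_cancel]
    calc R * S.conjTranspose = R * (F.conjTranspose * F + G.conjTranspose * G) *
          S.conjTranspose := by rw [this, mul_one]
      _ = _ := by noncomm_ring
  have h7 : ‖R * S.conjTranspose‖ ≤ ‖R * F.conjTranspose‖ * ‖F * S.conjTranspose‖ +
      ‖R * G.conjTranspose‖ * ‖G * S.conjTranspose‖ := by
    rw [h6]
    exact (norm_add_le _ _).trans
      (add_le_add (Matrix.frobenius_norm_mul _ _) (Matrix.frobenius_norm_mul _ _))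
  rw [h1, h2] at e1
  rw [h3, h4] at e2
  rw [h1, h3, h5]
  have n := norm_nonneg (R * S.conjTranspose)
  generalize ‖R * F.conjTranspose‖ = x at *
  generalize ‖F * S.conjTranspose‖ = y at *
  generalize ‖R * G.conjTranspose‖ = x' at *
  generalize ‖G * S.conjTranspose‖ = y' at *
  generalize ‖R * S.conjTranspose‖ = w at *
  have h8 : w ^ 2 ≤ (x * y + x' * y') ^ 2 := pow_le_pow_left₀ n h7 2
  have h9 : (x * y + x' * y') ^ 2 + (x * y' - x' * y) ^ 2 = 1 := by
    linear_combination (y ^ 2 + y' ^ 2) * e1 + e2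
  have h10 : (x * y - x' * y') ^ 2 + (x * y' + x' * y) ^ 2 = 1 := by
    linear_combination (y ^ 2 + y' ^ 2) * e1 + e2
  have h11 : x ^ 2 - y ^ 2 = (x * y' - x' * y) * (x * y' + x' * y) := by
    linear_combination x ^ 2 * (-e2) + y ^ 2 * e1
  have h12 : (x ^ 2 - y ^ 2) ^ 2 ≤ (x * y' - x' * y) ^ 2 := by
    rw [h11, mul_pow]
    exact mul_le_of_le_one_right (sq_nonneg _) (by linarith [sq_nonneg (x * y - x' * y')])
  linarith

theorem trace_mul_re_le_one {ρ σ : Op D} (hρ : IsState ρ) (hσ : IsState σ) :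
    (ρ * σ).trace.re ≤ 1 := by
  have := sq_trace_sub_mul_le hρ hσ (E := 0) Matrix.PosSemidef.zero (by
    simpa using Matrix.PosSemidef.one)
  simp at this
  linarith

theorem trace_mul_re_nonneg {ρ σ : Op D} (hρ : IsState ρ) (hσ : IsState σ) :
    0 ≤ (ρ * σ).trace.re := by
  obtain ⟨R, hR⟩ := exists_conjTranspose_mul_self hρ.1
  obtain ⟨S, hS⟩ := exists_conjTranspose_mul_self hσ.1
  rw [hR, hS, trace_mul_eq_frobenius_sq]
  positivity

theorem IsState.frobenius_sq {ρ : Op D} (hρ : IsState ρ) : ‖ρ‖ ^ 2 = (ρ * ρ).trace.re := by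
  rw [frobenius_sq_eq_trace, hρ.1.isHermitian.eq]

theorem IsState.frobenius_le_one {ρ : Op D} (hρ : IsState ρ) : ‖ρ‖ ≤ 1 := by
  have h := hρ.frobenius_sq
  have h' := trace_mul_re_le_one hρ hρ
  rw [← h] at h'
  exact (sq_le_one_iff₀ (norm_nonneg _)).1 h'

/-- A state of large purity is close to a pure state, the eigenstate of its largest
eigenvalue. -/
theorem IsState.exists_pure_near (hD : 0 < D) {ρ : Op D} (hρ : IsState ρ) {δ : ℝ}
    (h : 1 - δ ≤ (ρ * ρ).trace.re) : ∃ φ : Ket D, ‖φ‖ = 1 ∧ ‖ρ - proj φ‖ ≤ 2 * δ := by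
  have hH := hρ.1.isHermitian
  have h0 := hρ.1.eigenvalues_nonneg
  have : Nonempty (Fin D) := ⟨⟨0, hD⟩⟩
  obtain ⟨i, hi⟩ := Finite.exists_max hH.eigenvalues
  have hsum : ∑ j, hH.eigenvalues j = 1 := by
    have := hρ.2
    rw [hH.trace_eq_sum_eigenvalues] at this
    simpa using congrArg Complex.re this
  have hsq : (ρ * ρ).trace.re = ∑ j, hH.eigenvalues j ^ 2 := by
    have h1 := hH.spectral_theorem
    rw [Unitary.conjStarAlgAut_apply] at h1
    have h2 : ρ * ρ = (hH.eigenvectorUnitary : Op D) *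
        Matrix.diagonal (fun j => ((hH.eigenvalues j ^ 2 : ℝ) : ℂ)) *
          star (hH.eigenvectorUnitary : Op D) := by
      have h3 : star (hH.eigenvectorUnitary : Op D) * (hH.eigenvectorUnitary : Op D) = 1 :=
        Unitary.coe_star_mul_self _
      refine (congrArg₂ (· * ·) h1 h1).trans ?_
      rw [show ∀ U V L : Op D, U * L * V * (U * L * V) = U * L * (V * U) * (L * V) from
        fun U V L => by noncomm_ring, h3, mul_one, mul_assoc, ← mul_assoc (Matrix.diagonal _),
        Matrix.diagonal_mul_diagonal, ← mul_assoc]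
      congr 3
      ext j; simp [pow_two]
    rw [h2, Matrix.trace_mul_comm, ← mul_assoc, Unitary.coe_star_mul_self, one_mul,
      Matrix.trace_diagonal, Complex.re_sum]
    simp only [Complex.ofReal_re]
  have hφ : ‖hH.eigenvectorBasis i‖ = 1 := hH.eigenvectorBasis.orthonormal.1 i
  refine ⟨hH.eigenvectorBasis i, hφ, ?_⟩
  set l := hH.eigenvalues i with hl
  have htr : (proj (hH.eigenvectorBasis i) * ρ).trace.re = l := by
    rw [trace_proj_mul, hH.mulVec_eigenvectorBasis]
    have h2 : ∑ k, conj (hH.eigenvectorBasis i k) * hH.eigenvectorBasis i k = 1 := by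
      rw [← inner_eq_sum, inner_self_eq_norm_sq_to_K, hφ]; simp
    simp only [Pi.smul_apply, Complex.real_smul, mul_left_comm (conj _)]
    rw [← Finset.mul_sum, h2, mul_one, Complex.ofReal_re]
  have hF : ‖ρ - proj (hH.eigenvectorBasis i)‖ ^ 2 = (ρ * ρ).trace.re - 2 * l + 1 := by
    have h3 : (ρ - proj (hH.eigenvectorBasis i)).conjTranspose *
        (ρ - proj (hH.eigenvectorBasis i)) = ρ * ρ - ρ * proj (hH.eigenvectorBasis i) -
        proj (hH.eigenvectorBasis i) * ρ +
          proj (hH.eigenvectorBasis i) * proj (hH.eigenvectorBasis i) := by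
      rw [Matrix.conjTranspose_sub, proj_conjTranspose, hH.eq]; noncomm_ring
    rw [frobenius_sq_eq_trace, h3, proj_mul_self hφ, Matrix.trace_add, Matrix.trace_sub,
      Matrix.trace_sub, Matrix.trace_mul_comm ρ (proj _), trace_proj _ hφ, Complex.add_re,
      Complex.sub_re, Complex.sub_re, htr, Complex.one_re]
    ring
  have hle1 : ∑ j, hH.eigenvalues j ^ 2 ≤ l := by
    calc ∑ j, hH.eigenvalues j ^ 2 ≤ ∑ j, l * hH.eigenvalues j :=
          Finset.sum_le_sum fun j _ => by rw [pow_two]; exact mul_le_mul_of_nonneg_right (hi j) (h0 j)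
      _ = l := by rw [← Finset.mul_sum, hsum, mul_one]
  have hle2 : ∑ j, hH.eigenvalues j ^ 2 ≤ l ^ 2 + (1 - l) ^ 2 := by
    rw [← Finset.add_sum_erase _ _ (Finset.mem_univ i)]
    have h4 : ∑ j ∈ Finset.univ.erase i, hH.eigenvalues j = 1 - l := by
      rw [← hsum, ← Finset.add_sum_erase _ _ (Finset.mem_univ i)]; ring
    have h5 := Finset.sum_sq_le_sq_sum_of_nonneg (s := Finset.univ.erase i)
      (f := hH.eigenvalues) (fun j _ => h0 j)
    rw [h4] at h5
    linarith
  have hl1 : l ≤ 1 := by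
    rw [← hsum]; exact Finset.single_le_sum (fun j _ => h0 j) (Finset.mem_univ i)
  rw [hsq] at h hF
  have h1l : 1 - l ≤ δ := by linarith
  refine abs_le_of_sq_le_sq' ?_ (by linarith) |>.2
  nlinarith [mul_self_le_mul_self (sub_nonneg.2 hl1) h1l]

end Discrimination

/-! ### The witness -/

section Witness

open scoped Matrix.Norms.Frobenius

variable {D N : ℕ}

/-- A sum over unordered pairs, as half of the off-diagonal double sum. -/
theorem two_mul_sum_pairLabel (g : Fin N → Fin N → ℝ) (hg : ∀ i j, g i j = g j i) :
    2 * ∑ p : PairLabel N, g p.1.1 p.1.2 + ∑ i, g i i = ∑ i, ∑ j, g i j := by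
  have h1 : ∑ p : PairLabel N, g p.1.1 p.1.2 = ∑ i, ∑ j, if j < i then g i j else 0 := by
    rw [← Fintype.sum_prod_type' (f := fun i j => if j < i then g i j else 0),
      ← Finset.sum_filter]
    exact (Finset.sum_subtype (f := fun p : Fin N × Fin N => g p.1 p.2)
      (Finset.univ.filter fun p : Fin N × Fin N => p.2 < p.1) (by simp)).symm
  have h2 : ∑ i, ∑ j, (if j < i then g i j else 0) = ∑ i, ∑ j, if i < j then g i j else 0 := by
    rw [Finset.sum_comm]
    simp only [hg]
  have h3 : ∑ i, g i i = ∑ i, ∑ j, if i = j then g i j else 0 := by simp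
  rw [two_mul, h1]
  nth_rw 2 [h2]
  rw [h3, ← Finset.sum_add_distrib, ← Finset.sum_add_distrib]
  refine Finset.sum_congr rfl fun i _ => ?_
  rw [← Finset.sum_add_distrib, ← Finset.sum_add_distrib]
  refine Finset.sum_congr rfl fun j _ => ?_
  rcases lt_trichotomy i j with h | h | h
  · simp [h, h.not_gt, h.ne]
  · simp [h]
  · simp [h, h.not_gt, h.ne']

theorem trace_sum_mul_sum (α : Fin N → ℝ) (ρ : Fin N → Op D) :
    ((∑ i, (α i : ℂ) • ρ i) * (∑ i, (α i : ℂ) • ρ i)).trace.re =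
      ∑ i, ∑ j, α i * α j * (ρ i * ρ j).trace.re := by
  simp only [Finset.sum_mul, Finset.mul_sum, Matrix.trace_sum, Complex.re_sum, Matrix.smul_mul,
    Matrix.mul_smul, smul_smul, Matrix.trace_smul, smul_eq_mul]
  refine Finset.sum_congr rfl fun i _ => Finset.sum_congr rfl fun j _ => ?_
  rw [← Complex.ofReal_mul, Complex.re_ofReal_mul, Matrix.trace_mul_comm]

theorem ResolvesIdentity.sum_weights (hD : 0 < D) {Ψ : Fin N → Ket D} {α : Fin N → ℝ}
    (hΨ : ∀ i, ‖Ψ i‖ = 1) (h : ResolvesIdentity Ψ α) : ∑ i, α i = 1 := by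
  have h1 := congrArg (fun A => A.trace) h.2
  have hD' : (D : ℂ) ≠ 0 := by exact_mod_cast hD.ne'
  simp only [Matrix.trace_sum, Matrix.trace_smul, trace_proj _ (hΨ _), smul_eq_mul, mul_one,
    Matrix.trace_one, Fintype.card_fin, one_div_mul_cancel hD'] at h1
  exact_mod_cast h1

theorem ResolvesIdentity.sum_overlaps (hD : 0 < D) {Ψ : Fin N → Ket D} {α : Fin N → ℝ}
    (h : ResolvesIdentity Ψ α) :
    ∑ i, ∑ j, α i * α j * ‖inner ℂ (Ψ i) (Ψ j)‖ ^ 2 = 1 / (D : ℝ) := by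
  have hD' : (D : ℂ) ≠ 0 := by exact_mod_cast hD.ne'
  have h1 := trace_sum_mul_sum α (fun i => proj (Ψ i))
  rw [h.2] at h1
  simp only [trace_proj_mul_proj, Complex.ofReal_re] at h1
  rw [← h1]
  simp only [Matrix.smul_mul, one_mul, smul_smul, Matrix.trace_smul, Matrix.trace_one,
    Fintype.card_fin, smul_eq_mul]
  have : (1 / (D : ℂ)) * (1 / D) * D = ((1 / D : ℝ) : ℂ) := by
    push_cast; field_simp
  rw [this, Complex.ofReal_re]

/-- The maximally mixed state has minimal purity. -/
theorem one_div_le_frobenius_sq (hD : 0 < D) {A : Op D} (h : A.trace = 1) :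
    1 / (D : ℝ) ≤ ‖A‖ ^ 2 := by
  have h1 := norm_trace_mul_le A 1
  have h2 := frobenius_one_sq (D := D)
  rw [mul_one, h, norm_one] at h1
  have h3 : 1 ≤ ‖A‖ ^ 2 * D := by
    rw [← h2, ← mul_pow]; exact one_le_pow₀ h1
  rw [div_le_iff₀ (by exact_mod_cast hD)]
  exact h3

theorem one_div_le_sum_traces (hD : 0 < D) {α : Fin N → ℝ} (hα : ∑ i, α i = 1)
    {ρ : Fin N → Op D} (hρ : ∀ i, IsState (ρ i)) :
    1 / (D : ℝ) ≤ ∑ i, ∑ j, α i * α j * (ρ i * ρ j).trace.re := by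
  rw [← trace_sum_mul_sum]
  have hH : (∑ i, (α i : ℂ) • ρ i).conjTranspose = ∑ i, (α i : ℂ) • ρ i := by
    simp only [Matrix.conjTranspose_sum, Matrix.conjTranspose_smul, (hρ _).1.isHermitian.eq]
    simp
  have h := one_div_le_frobenius_sq hD (A := ∑ i, (α i : ℂ) • ρ i) (by
    simp only [Matrix.trace_sum, Matrix.trace_smul, (hρ _).2, smul_eq_mul, mul_one]
    exact_mod_cast hα)
  rwa [frobenius_sq_eq_trace, hH] at h

theorem witness_apply {Ψ : Fin N → Ket D} (hΨ : ∀ i, ‖Ψ i‖ = 1) (α : Fin N → ℝ)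
    (P : Fin N → PairLabel N → Fin 2 → ℝ) :
    witness Ψ α P = ∑ p : PairLabel N, α p.1.1 * α p.1.2 *
      (2 * pureGap (Ψ p.1.1) (Ψ p.1.2) * (P p.1.1 p 1 - P p.1.2 p 1)) := by
  simp only [witness, LinearMap.coe_mk, AddHom.coe_mk, traceNorm_proj_sub_proj (hΨ _) (hΨ _)]
  exact Finset.sum_congr rfl fun p _ => by ring

/-- The counterpart `√(1 - tr ρσ)` of `pureGap` for possibly mixed states. -/
noncomputable def stateGap (ρ σ : Op D) : ℝ := Real.sqrt (1 - (ρ * σ).trace.re)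

theorem stateGap_sq {ρ σ : Op D} (hρ : IsState ρ) (hσ : IsState σ) :
    stateGap ρ σ ^ 2 = 1 - (ρ * σ).trace.re :=
  Real.sq_sqrt (sub_nonneg.2 (trace_mul_re_le_one hρ hσ))

theorem stateGap_nonneg (ρ σ : Op D) : 0 ≤ stateGap ρ σ := Real.sqrt_nonneg _

theorem stateGap_le_one {ρ σ : Op D} (hρ : IsState ρ) (hσ : IsState σ) : stateGap ρ σ ≤ 1 :=
  Real.sqrt_le_one.2 (by linarith [trace_mul_re_nonneg hρ hσ])

theorem pureGap_comm (u v : Ket D) : pureGap u v = pureGap v u := by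
  rw [pureGap, pureGap, norm_inner_symm]

theorem stateGap_comm (ρ σ : Op D) : stateGap ρ σ = stateGap σ ρ := by
  rw [stateGap, stateGap, Matrix.trace_mul_comm]

theorem IsRealization.sub_le_stateGap {ρ : Fin N → Op D} {E : PairLabel N → Fin 2 → Op D}
    {P : Fin N → PairLabel N → Fin 2 → ℝ} (h : IsRealization ρ E P) (i j : Fin N)
    (p : PairLabel N) : P i p 1 - P j p 1 ≤ stateGap (ρ i) (ρ j) := by
  have e : ∀ i, P i p 1 = (ρ i * E p 1).trace.re := fun i => by
    rw [← h.prob i p 1, Complex.ofReal_re]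
  have hE : 1 - E p 1 = E p 0 := by
    rw [← (h.povm p).2, Fin.sum_univ_two, add_sub_cancel_right]
  rw [e, e]
  refine Real.le_sqrt_of_sq_le ?_
  exact sq_trace_sub_mul_le (h.state i) (h.state j) ((h.povm p).1 1)
    (by rw [hE]; exact (h.povm p).1 0)

/-- How far a realization is from saturating the witness. The three ingredients are
`tr((ρ_i - ρ_j) E) ≤ √(1 - tr ρ_i ρ_j)`, the identity `2 a s = a² + s² - (a - s)²`, and the
bound `tr ρ̄² ≥ 1 / D` for the mean state `ρ̄`. -/
theorem witness_add_deficit_le (hD : 0 < D) {Ψ : Fin N → Ket D} {α : Fin N → ℝ}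
    (hΨ : ∀ i, ‖Ψ i‖ = 1) (hα : ResolvesIdentity Ψ α) {ρ : Fin N → Op D}
    {E : PairLabel N → Fin 2 → Op D} {P : Fin N → PairLabel N → Fin 2 → ℝ}
    (h : IsRealization ρ E P) :
    witness Ψ α P + ∑ p : PairLabel N, α p.1.1 * α p.1.2 *
        (pureGap (Ψ p.1.1) (Ψ p.1.2) - stateGap (ρ p.1.1) (ρ p.1.2)) ^ 2
      + 1 / 2 * ∑ i, α i ^ 2 * (1 - (ρ i * ρ i).trace.re) ≤ 1 - 1 / (D : ℝ) := by
  have hsum := hα.sum_weights hD hΨ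
  have h1 := hα.sum_overlaps hD
  have h2 := one_div_le_sum_traces hD hsum h.state
  have h3 := two_mul_sum_pairLabel (fun i j => α i * α j *
    (pureGap (Ψ i) (Ψ j) ^ 2 + stateGap (ρ i) (ρ j) ^ 2)) (fun i j => by
      rw [pureGap_comm, stateGap_comm]; ring)
  have h4 : ∑ i, ∑ j, α i * α j * (pureGap (Ψ i) (Ψ j) ^ 2 + stateGap (ρ i) (ρ j) ^ 2) =
      2 - (∑ i, ∑ j, α i * α j * ‖inner ℂ (Ψ i) (Ψ j)‖ ^ 2) -
        ∑ i, ∑ j, α i * α j * (ρ i * ρ j).trace.re := by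
    have h5 : (2 : ℝ) = ∑ i, ∑ j, α i * α j * 2 := by
      simp only [← Finset.sum_mul, ← Finset.mul_sum, hsum]; norm_num
    rw [h5]
    simp only [← Finset.sum_sub_distrib]
    refine Finset.sum_congr rfl fun i _ => Finset.sum_congr rfl fun j _ => ?_
    rw [pureGap_sq (hΨ i) (hΨ j), stateGap_sq (h.state i) (h.state j)]
    ring
  have h6 : ∑ i, α i * α i * (pureGap (Ψ i) (Ψ i) ^ 2 + stateGap (ρ i) (ρ i) ^ 2) =
      ∑ i, α i ^ 2 * (1 - (ρ i * ρ i).trace.re) := by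
    refine Finset.sum_congr rfl fun i _ => ?_
    rw [pureGap_sq (hΨ i) (hΨ i), stateGap_sq (h.state i) (h.state i),
      inner_self_eq_norm_sq_to_K, hΨ i]
    simp only [RCLike.ofReal_one, one_pow, norm_one]
    ring
  have h7 : witness Ψ α P + ∑ p : PairLabel N, α p.1.1 * α p.1.2 *
        (pureGap (Ψ p.1.1) (Ψ p.1.2) - stateGap (ρ p.1.1) (ρ p.1.2)) ^ 2 ≤
      ∑ p : PairLabel N, α p.1.1 * α p.1.2 *
        (pureGap (Ψ p.1.1) (Ψ p.1.2) ^ 2 + stateGap (ρ p.1.1) (ρ p.1.2) ^ 2) := by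
    rw [witness_apply hΨ, ← Finset.sum_add_distrib]
    refine Finset.sum_le_sum fun p _ => ?_
    rw [← mul_add]
    refine mul_le_mul_of_nonneg_left ?_ (mul_pos (hα.1 _) (hα.1 _)).le
    have h8 := mul_le_mul_of_nonneg_left (h.sub_le_stateGap p.1.1 p.1.2 p)
      (pureGap_nonneg (Ψ p.1.1) (Ψ p.1.2))
    nlinarith
  rw [h4, h1, h6] at h3
  linarith

theorem witness_le (hD : 0 < D) {Ψ : Fin N → Ket D} {α : Fin N → ℝ}
    (hΨ : ∀ i, ‖Ψ i‖ = 1) (hα : ResolvesIdentity Ψ α)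
    {P : Fin N → PairLabel N → Fin 2 → ℝ} (h : P ∈ behaviours D (Fin N) (PairLabel N) (Fin 2)) :
    witness Ψ α P ≤ 1 - 1 / (D : ℝ) := by
  obtain ⟨ρ, E, h⟩ := h
  have h1 := witness_add_deficit_le hD hΨ hα h
  have h2 : 0 ≤ ∑ p : PairLabel N, α p.1.1 * α p.1.2 *
        (pureGap (Ψ p.1.1) (Ψ p.1.2) - stateGap (ρ p.1.1) (ρ p.1.2)) ^ 2 :=
    Finset.sum_nonneg fun p _ => mul_nonneg (mul_pos (hα.1 _) (hα.1 _)).le (sq_nonneg _)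
  have h3 : 0 ≤ ∑ i, α i ^ 2 * (1 - (ρ i * ρ i).trace.re) :=
    Finset.sum_nonneg fun i _ => mul_nonneg (sq_nonneg _)
      (sub_nonneg.2 (trace_mul_re_le_one (h.state i) (h.state i)))
  linarith

/-- The maximum of the witness is attained by the reference states and the Helstrom
measurements. -/
theorem isGreatest_witness (hD : 0 < D) {Ψ : Fin N → Ket D} {α : Fin N → ℝ}
    (hΨ : ∀ i, ‖Ψ i‖ = 1) (hα : ResolvesIdentity Ψ α) :
    IsGreatest (witness Ψ α '' behaviours D (Fin N) (PairLabel N) (Fin 2)) (1 - 1 / (D : ℝ)) := by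
  constructor
  · refine ⟨fun x p b => (proj (Ψ x) * helstrom (Ψ p.1.1) (Ψ p.1.2) b).trace.re,
      ⟨fun x => proj (Ψ x), fun p => helstrom (Ψ p.1.1) (Ψ p.1.2), fun x => isState_proj (hΨ x),
        fun p => isPOVM_helstrom (hΨ _) (hΨ _), fun x p b => ?_⟩, ?_⟩
    · have hE := ((isPOVM_helstrom (hΨ p.1.1) (hΨ p.1.2)).1 b).isHermitian
      refine Complex.conj_eq_iff_re.1 ?_
      have h := Matrix.trace_conjTranspose (proj (Ψ x) * helstrom (Ψ p.1.1) (Ψ p.1.2) b)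
      rw [Matrix.conjTranspose_mul, hE.eq, proj_conjTranspose, Matrix.trace_mul_comm] at h
      exact h.symm
    · rw [witness_apply hΨ]
      have h1 := hα.sum_overlaps hD
      have h3 := two_mul_sum_pairLabel (fun i j => α i * α j * (2 * pureGap (Ψ i) (Ψ j) ^ 2))
        (fun i j => by rw [pureGap_comm]; ring)
      have h4 : ∑ i, ∑ j, α i * α j * (2 * pureGap (Ψ i) (Ψ j) ^ 2) =
          2 - 2 * ∑ i, ∑ j, α i * α j * ‖inner ℂ (Ψ i) (Ψ j)‖ ^ 2 := by
        have h5 : (2 : ℝ) - 2 * ∑ i, ∑ j, α i * α j * ‖inner ℂ (Ψ i) (Ψ j)‖ ^ 2 =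
            (∑ i, ∑ j, α i * α j * 2) -
              2 * ∑ i, ∑ j, α i * α j * ‖inner ℂ (Ψ i) (Ψ j)‖ ^ 2 := by
          simp only [← Finset.sum_mul, ← Finset.mul_sum, hα.sum_weights hD hΨ]; norm_num
        rw [h5]
        simp only [Finset.mul_sum, ← Finset.sum_sub_distrib]
        refine Finset.sum_congr rfl fun i _ => Finset.sum_congr rfl fun j _ => ?_
        rw [pureGap_sq (hΨ i) (hΨ j)]
        ring
      have h6 : ∑ i, α i * α i * (2 * pureGap (Ψ i) (Ψ i) ^ 2) = 0 := by
        refine Finset.sum_eq_zero fun i _ => ?_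
        rw [pureGap_sq (hΨ i) (hΨ i), inner_self_eq_norm_sq_to_K, hΨ i]
        simp
      rw [h4, h1, h6] at h3
      have h7 : ∀ p : PairLabel N, 2 * pureGap (Ψ p.1.1) (Ψ p.1.2) *
          ((proj (Ψ p.1.1) * helstrom (Ψ p.1.1) (Ψ p.1.2) 1).trace.re -
            (proj (Ψ p.1.2) * helstrom (Ψ p.1.1) (Ψ p.1.2) 1).trace.re) =
          2 * pureGap (Ψ p.1.1) (Ψ p.1.2) ^ 2 := by
        intro p
        rw [← Complex.sub_re, ← Matrix.trace_sub, ← Matrix.sub_mul,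
          trace_mul_helstrom (hΨ _) (hΨ _), Complex.ofReal_re]
        ring
      simp only [h7]
      linarith
  · rintro _ ⟨P, hP, rfl⟩
    exact witness_le hD hΨ hα hP

/-- Near-optimal realizations nearly reproduce the overlaps of the reference states. -/
theorem abs_trace_sub_overlap_le (hD : 0 < D) {Ψ : Fin N → Ket D} {α : Fin N → ℝ}
    (hΨ : ∀ i, ‖Ψ i‖ = 1) (hα : ResolvesIdentity Ψ α) {a : ℝ} (ha : 0 < a) (haα : ∀ i, a ≤ α i)
    {ρ : Fin N → Op D} {E : PairLabel N → Fin 2 → Op D} {P : Fin N → PairLabel N → Fin 2 → ℝ}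
    (h : IsRealization ρ E P) {q : ℝ} (hq : 0 ≤ q) (hq1 : q ≤ 1)
    (hW : 1 - 1 / (D : ℝ) - q ^ 2 ≤ witness Ψ α P) (i j : Fin N) :
    |(ρ i * ρ j).trace.re - ‖inner ℂ (Ψ i) (Ψ j)‖ ^ 2| ≤ (2 / a + 2 / a ^ 2) * q := by
  have h1 := witness_add_deficit_le hD hΨ hα h
  have t2 : ∀ p : PairLabel N, 0 ≤ α p.1.1 * α p.1.2 *
        (pureGap (Ψ p.1.1) (Ψ p.1.2) - stateGap (ρ p.1.1) (ρ p.1.2)) ^ 2 :=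
    fun p => mul_nonneg (mul_pos (hα.1 _) (hα.1 _)).le (sq_nonneg _)
  have t3 : ∀ i, 0 ≤ α i ^ 2 * (1 - (ρ i * ρ i).trace.re) :=
    fun i => mul_nonneg (sq_nonneg _)
      (sub_nonneg.2 (trace_mul_re_le_one (h.state i) (h.state i)))
  have h2 := Finset.sum_nonneg fun p (_ : p ∈ Finset.univ) => t2 p
  have h3 := Finset.sum_nonneg fun i (_ : i ∈ Finset.univ) => t3 i
  have hq2 : 0 ≤ q * (1 - q) := mul_nonneg hq (sub_nonneg.2 hq1)
  have key : ∀ i j, j < i →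
      |(ρ i * ρ j).trace.re - ‖inner ℂ (Ψ i) (Ψ j)‖ ^ 2| ≤ 2 / a * q := by
    intro i j hij
    have h4 := Finset.single_le_sum (fun p _ => t2 p)
      (Finset.mem_univ (⟨(i, j), hij⟩ : PairLabel N))
    simp only at h4
    have h5 : (a * (pureGap (Ψ i) (Ψ j) - stateGap (ρ i) (ρ j))) ^ 2 ≤ q ^ 2 := by
      calc (a * (pureGap (Ψ i) (Ψ j) - stateGap (ρ i) (ρ j))) ^ 2
          = a * a * (pureGap (Ψ i) (Ψ j) - stateGap (ρ i) (ρ j)) ^ 2 := by ring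
        _ ≤ α i * α j * (pureGap (Ψ i) (Ψ j) - stateGap (ρ i) (ρ j)) ^ 2 := by
            gcongr
            · exact (hα.1 i).le
            · exact haα i
            · exact haα j
        _ ≤ q ^ 2 := by linarith
    have h6 := abs_le_of_sq_le_sq h5 hq
    rw [abs_mul, abs_of_pos ha] at h6
    have h7 : (ρ i * ρ j).trace.re - ‖inner ℂ (Ψ i) (Ψ j)‖ ^ 2 =
        (pureGap (Ψ i) (Ψ j) - stateGap (ρ i) (ρ j)) *
          (pureGap (Ψ i) (Ψ j) + stateGap (ρ i) (ρ j)) := by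
      have e1 := pureGap_sq (hΨ i) (hΨ j)
      have e2 := stateGap_sq (h.state i) (h.state j)
      linear_combination e2 - e1
    rw [h7, abs_mul, abs_of_nonneg (add_nonneg (pureGap_nonneg _ _) (stateGap_nonneg _ _))]
    have h8 : pureGap (Ψ i) (Ψ j) + stateGap (ρ i) (ρ j) ≤ 2 := by
      linarith [pureGap_le_one (Ψ i) (Ψ j), stateGap_le_one (h.state i) (h.state j)]
    calc _ ≤ |pureGap (Ψ i) (Ψ j) - stateGap (ρ i) (ρ j)| * 2 :=
          mul_le_mul_of_nonneg_left h8 (abs_nonneg _)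
      _ ≤ q / a * 2 := by
          gcongr
          rw [le_div_iff₀ ha]; linarith
      _ = 2 / a * q := by ring
  have hle : 2 / a * q ≤ (2 / a + 2 / a ^ 2) * q := by
    gcongr
    have : 0 ≤ 2 / a ^ 2 := by positivity
    linarith
  rcases lt_trichotomy i j with hij | rfl | hij
  · refine le_trans (le_of_eq ?_) ((key j i hij).trans hle)
    rw [Matrix.trace_mul_comm, norm_inner_symm]
  · have h4 := Finset.single_le_sum (fun i _ => t3 i) (Finset.mem_univ i)
    have h5 : a ^ 2 * (1 - (ρ i * ρ i).trace.re) ≤ α i ^ 2 * (1 - (ρ i * ρ i).trace.re) :=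
      mul_le_mul_of_nonneg_right (pow_le_pow_left₀ ha.le (haα i) 2)
        (sub_nonneg.2 (trace_mul_re_le_one (h.state i) (h.state i)))
    have h6 : 1 - (ρ i * ρ i).trace.re ≤ 2 / a ^ 2 * q := by
      rw [div_mul_eq_mul_div, le_div_iff₀ (by positivity)]
      nlinarith
    have h7 := trace_mul_re_le_one (h.state i) (h.state i)
    rw [inner_self_eq_norm_sq_to_K, hΨ i]
    simp only [RCLike.ofReal_one, one_pow, norm_one]
    rw [abs_sub_comm, abs_of_nonneg (by linarith)]
    refine h6.trans ?_
    have : 0 ≤ 2 / a * q := by positivity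
    linarith
  · exact (key i j hij).trans hle

end Witness

/-! ### Reconstructing pure states from coherences of neighbouring levels -/

section Coherences

open scoped Matrix.Norms.Frobenius

variable {D : ℕ}

theorem proj_apply (v : Ket D) (a b : Fin D) : proj v a b = v a * conj (v b) := rfl

theorem norm_apply_le_one {v : Ket D} (hv : ‖v‖ = 1) (a : Fin D) : ‖v a‖ ≤ 1 :=
  hv ▸ PiLp.norm_apply_le v a

theorem abs_sq_norm_sub_le {x y : ℂ} {γ : ℝ} (hx : ‖x‖ ≤ 1) (hy : ‖y‖ ≤ 1)
    (h : |‖x‖ - ‖y‖| ≤ γ / 2) : |‖x‖ ^ 2 - ‖y‖ ^ 2| ≤ γ := by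
  have hs : ‖x‖ ^ 2 - ‖y‖ ^ 2 = (‖x‖ - ‖y‖) * (‖x‖ + ‖y‖) := by ring
  rw [hs, abs_mul, abs_of_nonneg (by positivity : 0 ≤ ‖x‖ + ‖y‖)]
  calc |‖x‖ - ‖y‖| * (‖x‖ + ‖y‖) ≤ γ / 2 * 2 :=
        mul_le_mul h (by linarith) (by positivity) ((abs_nonneg _).trans h)
    _ = γ := by ring

theorem abs_norm_mul_sub_le {x x' y y' : ℂ} {γ : ℝ} (hy : ‖y‖ ≤ 1) (hx' : ‖x'‖ ≤ 1)
    (h : |‖x‖ - ‖x'‖| ≤ γ / 2) (h' : |‖y‖ - ‖y'‖| ≤ γ / 2) :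
    |‖x‖ * ‖y‖ - ‖x'‖ * ‖y'‖| ≤ γ := by
  have hs : ‖x‖ * ‖y‖ - ‖x'‖ * ‖y'‖ = (‖x‖ - ‖x'‖) * ‖y‖ + ‖x'‖ * (‖y‖ - ‖y'‖) := by ring
  rw [hs]
  refine (abs_add_le _ _).trans ?_
  rw [abs_mul, abs_mul, abs_norm, abs_norm]
  have h1 := mul_le_mul h hy (norm_nonneg _) ((abs_nonneg _).trans h)
  have h2 := mul_le_mul hx' h' (abs_nonneg _) zero_le_one
  linarith

/-- Coherences involving an unoccupied level are small. -/
theorem norm_proj_sub_le_of_eq_zero {z c : Ket D} {γ : ℝ} (hz : ∀ a, ‖z a‖ ≤ 1)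
    (hmod : ∀ a, |‖z a‖ - ‖c a‖| ≤ γ / 2) {a b : Fin D} (h : c a = 0 ∨ c b = 0) :
    ‖proj z a b - proj c a b‖ ≤ γ := by
  have h0 : proj c a b = 0 := by rcases h with h | h <;> simp [proj_apply, h]
  have hγ : 0 ≤ γ / 2 := (abs_nonneg _).trans (hmod a)
  rw [h0, sub_zero, proj_apply, norm_mul, RCLike.norm_conj]
  rcases h with h | h
  · have h1 := hmod a
    rw [h, norm_zero, sub_zero, abs_norm] at h1
    have := mul_le_mul h1 (hz b) (norm_nonneg _) hγ
    linarith
  · have h1 := hmod b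
    rw [h, norm_zero, sub_zero, abs_norm] at h1
    have := mul_le_mul (hz a) h1 (norm_nonneg _) zero_le_one
    linarith

/-- Propagation of coherences: for pure states, `Z_{ab} Z_{bd} = Z_{bb} Z_{ad}`, so the populations
and the coherences of neighbouring levels determine all coherences, as long as no unoccupied level
lies between two occupied ones. -/
theorem norm_proj_sub_le_of_adjacent {z c : Ket D} {γ m : ℝ} (hm : 0 < m) (hm1 : m ≤ 1)
    (hz : ∀ a, ‖z a‖ ≤ 1) (hc : ∀ a, ‖c a‖ ≤ 1) (hmod : ∀ a, |‖z a‖ - ‖c a‖| ≤ γ / 2)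
    {κ : ℝ} (hκ : γ ≤ κ)
    (hadj : ∀ (k : ℕ) (hk : k + 1 < D), ‖proj z ⟨k, by omega⟩ ⟨k + 1, hk⟩ -
      proj c ⟨k, by omega⟩ ⟨k + 1, hk⟩‖ ≤ κ)
    (hsupp : ∀ a b d : Fin D, a < b → b < d → m ≤ ‖c b‖ ^ 2 ∨ c a = 0 ∨ c d = 0) (a b : Fin D) :
    ‖proj z a b - proj c a b‖ ≤ (3 / m) ^ D * κ := by
  have hγ : 0 ≤ γ := by linarith [(abs_nonneg _).trans (hmod a)]
  have h3m : 1 ≤ 3 / m := by rw [le_div_iff₀ hm]; linarith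
  have hdiag : ∀ a, ‖proj z a a - proj c a a‖ ≤ γ := by
    intro a
    rw [proj_apply, proj_apply, Complex.mul_conj', Complex.mul_conj']
    have := abs_sq_norm_sub_le (hz a) (hc a) (hmod a)
    rw [← Real.norm_eq_abs, ← Complex.norm_real] at this
    exact_mod_cast this
  have hle1 : ∀ {v : Ket D}, (∀ a, ‖v a‖ ≤ 1) → ∀ a b, ‖proj v a b‖ ≤ 1 := by
    intro v hv a b
    rw [proj_apply, norm_mul, RCLike.norm_conj]
    exact mul_le_one₀ (hv a) (norm_nonneg _) (hv b)
  have key : ∀ (n k : ℕ) (hk : k + n < D), ‖proj z ⟨k, by omega⟩ ⟨k + n, hk⟩ -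
      proj c ⟨k, by omega⟩ ⟨k + n, hk⟩‖ ≤ (3 / m) ^ n * κ := by
    intro n
    induction n with
    | zero => intro k hk; simpa using (hdiag ⟨k, hk⟩).trans hκ
    | succ n ih =>
      intro k hk
      have hK : 1 ≤ (3 / m) ^ n := one_le_pow₀ h3m
      have hK' : κ ≤ (3 / m) ^ (n + 1) * κ :=
        le_mul_of_one_le_left (hγ.trans hκ) (one_le_pow₀ h3m)
      rcases Nat.eq_zero_or_pos n with rfl | hn
      · exact (hadj k hk).trans hK'
      · have i1 := ih k (by omega)
        have i2 := hadj (k + n) (by omega)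
        set A : Fin D := ⟨k, by omega⟩
        set B : Fin D := ⟨k + n, by omega⟩
        set C : Fin D := ⟨k + (n + 1), hk⟩
        have i2' : ‖proj z B C - proj c B C‖ ≤ κ := i2
        rcases hsupp A B C (Fin.mk_lt_mk.2 (by omega)) (Fin.mk_lt_mk.2 (by omega)) with h | h
        · have e : ((‖c B‖ ^ 2 : ℝ) : ℂ) * (proj z A C - proj c A C) =
              (proj c B B - proj z B B) * proj z A C + ((proj z A B - proj c A B) * proj z B C +
                proj c A B * (proj z B C - proj c B C)) := by
            push_cast
            rw [← Complex.mul_conj']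
            simp only [proj_apply]
            ring
          have e2 := congrArg norm e
          rw [norm_mul, Complex.norm_real, Real.norm_eq_abs, abs_of_nonneg (sq_nonneg _)] at e2
          have b1 : ‖(proj c B B - proj z B B) * proj z A C‖ ≤ κ * 1 := by
            rw [norm_mul, norm_sub_rev]
            exact mul_le_mul ((hdiag B).trans hκ) (hle1 hz _ _) (norm_nonneg _) (hγ.trans hκ)
          have b2 : ‖(proj z A B - proj c A B) * proj z B C‖ ≤ (3 / m) ^ n * κ * 1 := by
            rw [norm_mul]
            exact mul_le_mul i1 (hle1 hz _ _) (norm_nonneg _)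
              (mul_nonneg (by positivity) (hγ.trans hκ))
          have b3 : ‖proj c A B * (proj z B C - proj c B C)‖ ≤ 1 * κ := by
            rw [norm_mul]
            exact mul_le_mul (hle1 hc _ _) i2' (norm_nonneg _) zero_le_one
          have b4 : κ ≤ (3 / m) ^ n * κ := le_mul_of_one_le_left (hγ.trans hκ) hK
          have b5 : m * ‖proj z A C - proj c A C‖ ≤ 3 * ((3 / m) ^ n * κ) := by
            calc m * ‖proj z A C - proj c A C‖ ≤ ‖c B‖ ^ 2 * ‖proj z A C - proj c A C‖ := by
                  gcongr
              _ ≤ _ := by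
                  rw [e2]
                  refine (norm_add_le _ _).trans ?_
                  have := norm_add_le ((proj z A B - proj c A B) * proj z B C)
                    (proj c A B * (proj z B C - proj c B C))
                  linarith
          rw [pow_succ, mul_assoc, mul_comm (3 / m) κ, ← mul_assoc, ← mul_div_assoc,
            le_div_iff₀ hm]
          linarith
        · exact ((norm_proj_sub_le_of_eq_zero hz hmod h).trans hκ).trans hK'
  have key2 : ∀ a b : Fin D, a ≤ b → ‖proj z a b - proj c a b‖ ≤ (3 / m) ^ D * κ := by
    intro a b hab
    have hab' : (a : ℕ) ≤ b := hab
    have h := key (b - a) a (by omega)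
    have hb : (⟨a + (b - a), by omega⟩ : Fin D) = b := Fin.ext (by simp; omega)
    rw [hb] at h
    exact h.trans (mul_le_mul_of_nonneg_right (pow_le_pow_right₀ h3m (by omega)) (hγ.trans hκ))
  rcases le_total a b with h | h
  · exact key2 a b h
  · have e : proj z a b - proj c a b = conj (proj z b a - proj c b a) := by
      simp only [proj_apply, map_sub, map_mul, Complex.conj_conj]; ring
    rw [e, RCLike.norm_conj]
    exact key2 b a h

/-- Overlaps depend continuously on the coherences. -/
theorem abs_overlap_sub_le {u u' w : Ket D} {κ : ℝ} (hκ : 0 ≤ κ) (hw : ‖w‖ = 1)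
    (h : ∀ a b, ‖proj u a b - proj u' a b‖ ≤ κ) :
    |‖inner ℂ u w‖ ^ 2 - ‖inner ℂ u' w‖ ^ 2| ≤ D * κ := by
  have e : ((‖inner ℂ u w‖ ^ 2 - ‖inner ℂ u' w‖ ^ 2 : ℝ) : ℂ) =
      ((proj u - proj u') * proj w).trace := by
    rw [Matrix.sub_mul, Matrix.trace_sub, trace_proj_mul_proj, trace_proj_mul_proj]
    push_cast; rfl
  rw [← Real.norm_eq_abs, ← Complex.norm_real, e]
  calc _ ≤ ‖proj u - proj u'‖ * ‖proj w‖ := norm_trace_mul_le _ _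
    _ ≤ D * κ * 1 := mul_le_mul (frobenius_le_of_entry_le hκ h)
        (isState_proj hw).frobenius_le_one (norm_nonneg _) (by positivity)
    _ = D * κ := mul_one _

/-- The superposition `(|k⟩ + σ |k+1⟩) / √2` of neighbouring levels in the computational basis. -/
noncomputable def pairKet (D k : ℕ) (σ : ℂ) : Ket D :=
  WithLp.toLp 2 fun l => if (l : ℕ) = k then ((Real.sqrt 2)⁻¹ : ℂ) else
    if (l : ℕ) = k + 1 then ((Real.sqrt 2)⁻¹ : ℂ) * σ else 0

/-- The superposition `(σ |k⟩ + |k+1⟩ + τ |k+2⟩) / √3` in the computational basis. -/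
noncomputable def tripleKet (D k : ℕ) (σ τ : ℂ) : Ket D :=
  WithLp.toLp 2 fun l => if (l : ℕ) = k then ((Real.sqrt 3)⁻¹ : ℂ) * σ else
    if (l : ℕ) = k + 1 then ((Real.sqrt 3)⁻¹ : ℂ) else
      if (l : ℕ) = k + 2 then ((Real.sqrt 3)⁻¹ : ℂ) * τ else 0

theorem inv_sqrt_mul_self (n : ℕ) : ((Real.sqrt n)⁻¹ : ℂ) * ((Real.sqrt n)⁻¹ : ℂ) = (n : ℂ)⁻¹ := by
  have : Real.sqrt n * Real.sqrt n = n := Real.mul_self_sqrt (Nat.cast_nonneg n)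
  rw [← mul_inv]
  congr 1
  exact_mod_cast this

theorem pairKet_left {k : ℕ} (hk : k + 1 < D) (σ : ℂ) :
    pairKet D k σ ⟨k, by omega⟩ = ((Real.sqrt 2)⁻¹ : ℂ) := by simp [pairKet]

theorem pairKet_right {k : ℕ} (hk : k + 1 < D) (σ : ℂ) :
    pairKet D k σ ⟨k + 1, hk⟩ = ((Real.sqrt 2)⁻¹ : ℂ) * σ := by simp [pairKet]

theorem pairKet_eq_zero {k : ℕ} (σ : ℂ) {l : Fin D} (h : (l : ℕ) ≠ k) (h' : (l : ℕ) ≠ k + 1) :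
    pairKet D k σ l = 0 := by simp [pairKet, h, h']

theorem inner_pairKet {k : ℕ} (hk : k + 1 < D) (σ : ℂ) (w : Ket D) :
    inner ℂ (pairKet D k σ) w =
      ((Real.sqrt 2)⁻¹ : ℂ) * (w ⟨k, by omega⟩ + conj σ * w ⟨k + 1, hk⟩) := by
  rw [inner_eq_sum, Fintype.sum_eq_add (⟨k, by omega⟩ : Fin D) ⟨k + 1, hk⟩ (by simp)]
  · rw [pairKet_left hk, pairKet_right hk]
    simp only [map_mul, map_inv₀, Complex.conj_ofReal]
    ring
  · rintro x ⟨h1, h2⟩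
    rw [pairKet_eq_zero σ (fun h => h1 (Fin.ext h)) (fun h => h2 (Fin.ext h))]
    simp

theorem norm_inner_pairKet_sq {k : ℕ} (hk : k + 1 < D) {σ : ℂ} (hσ : ‖σ‖ = 1) (w : Ket D) :
    ‖inner ℂ (pairKet D k σ) w‖ ^ 2 = (‖w ⟨k, by omega⟩‖ ^ 2 + ‖w ⟨k + 1, hk⟩‖ ^ 2) / 2 +
      (σ * proj w ⟨k, by omega⟩ ⟨k + 1, hk⟩).re := by
  have h2 : ‖((Real.sqrt 2)⁻¹ : ℂ)‖ ^ 2 = 1 / 2 := by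
    rw [norm_inv, Complex.norm_real, Real.norm_eq_abs, inv_pow, sq_abs,
      Real.sq_sqrt (by norm_num)]
    norm_num
  have hσ2 : σ.re * σ.re + σ.im * σ.im = 1 := by
    rw [← Complex.normSq_apply, Complex.normSq_eq_norm_sq, hσ]; norm_num
  rw [inner_pairKet hk, norm_mul, mul_pow, h2, proj_apply]
  simp only [← Complex.normSq_eq_norm_sq, Complex.normSq_apply, Complex.add_re, Complex.add_im,
    Complex.mul_re, Complex.mul_im, Complex.conj_re, Complex.conj_im]
  linear_combination ((w ⟨k + 1, hk⟩).re ^ 2 + (w ⟨k + 1, hk⟩).im ^ 2) / 2 * hσ2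

/-- If `u` is close to `(|k⟩ + σ |k+1⟩) / √2`, its overlap with `w` determines the quadrature of the
coherence of `w` between the levels `k` and `k+1` selected by `σ`. -/
theorem abs_re_mul_coherence_sub_le {k : ℕ} (hk : k + 1 < D) {σ τ : ℂ} (hσ : ‖σ‖ = 1)
    (hτ : ‖τ‖ = 1) {u w c : Ket D} {γ κ : ℝ} (hκ : 0 ≤ κ) (hw : ‖w‖ = 1) (hc : ‖c‖ = 1)
    (hmod : ∀ a, |‖w a‖ - ‖c a‖| ≤ γ / 2)
    (hu : ∀ a b, ‖proj u a b - proj (pairKet D k σ) a b‖ ≤ κ)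
    (hov : |‖inner ℂ u w‖ ^ 2 - ‖inner ℂ (pairKet D k τ) c‖ ^ 2| ≤ γ) :
    |(σ * proj w ⟨k, by omega⟩ ⟨k + 1, hk⟩).re - (τ * proj c ⟨k, by omega⟩ ⟨k + 1, hk⟩).re| ≤
      D * κ + 2 * γ := by
  have h1 := abs_overlap_sub_le hκ hw hu
  rw [norm_inner_pairKet_sq hk hσ] at h1
  rw [norm_inner_pairKet_sq hk hτ] at hov
  have h2 := abs_sq_norm_sub_le (norm_apply_le_one hw _) (norm_apply_le_one hc _)
    (hmod ⟨k, by omega⟩)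
  have h3 := abs_sq_norm_sub_le (norm_apply_le_one hw _) (norm_apply_le_one hc _)
    (hmod ⟨k + 1, hk⟩)
  rw [abs_le] at *
  constructor <;> linarith

theorem norm_pairKet_sq {k : ℕ} {σ : ℂ} (hσ : ‖σ‖ = 1) {l : Fin D} (h : k ≤ (l : ℕ))
    (h' : (l : ℕ) ≤ k + 1) : ‖pairKet D k σ l‖ ^ 2 = 1 / 2 := by
  have h2 : ‖((Real.sqrt 2)⁻¹ : ℂ)‖ ^ 2 = 1 / 2 := by
    rw [norm_inv, Complex.norm_real, Real.norm_eq_abs, inv_pow, sq_abs,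
      Real.sq_sqrt (by norm_num)]
    norm_num
  simp only [pairKet]
  split_ifs
  · exact h2
  · rw [norm_mul, hσ, mul_one, h2]
  · omega

theorem pairKet_contiguous {k : ℕ} {σ : ℂ} (hσ : ‖σ‖ = 1) {a b d : Fin D} (hab : a < b)
    (hbd : b < d) :
    1 / 3 ≤ ‖pairKet D k σ b‖ ^ 2 ∨ pairKet D k σ a = 0 ∨ pairKet D k σ d = 0 := by
  have hab' : (a : ℕ) < b := hab
  have hbd' : (b : ℕ) < d := hbd
  by_cases hb : k ≤ (b : ℕ) ∧ (b : ℕ) ≤ k + 1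
  · left; rw [norm_pairKet_sq hσ hb.1 hb.2]; norm_num
  · right
    rcases lt_or_ge (b : ℕ) k with h | h
    · exact Or.inl (pairKet_eq_zero σ (by omega) (by omega))
    · exact Or.inr (pairKet_eq_zero σ (by omega) (by omega))

/-- A pure state with populations close to those of `pairKet D k σ` is determined by its coherence
between the levels `k` and `k+1`. -/
theorem norm_proj_sub_pairKet_le {k : ℕ} (hk : k + 1 < D) {σ : ℂ} (hσ : ‖σ‖ = 1) {u : Ket D}
    {γ κ : ℝ} (hγκ : γ ≤ κ) (hu : ‖u‖ = 1) (hmod : ∀ a, |‖u a‖ - ‖pairKet D k σ a‖| ≤ γ / 2)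
    (h : ‖proj u ⟨k, by omega⟩ ⟨k + 1, hk⟩ - conj σ / 2‖ ≤ κ) (a b : Fin D) :
    ‖proj u a b - proj (pairKet D k σ) a b‖ ≤ 9 ^ D * κ := by
  have h9 : (9 : ℝ) = 3 / (1 / 3) := by norm_num
  rw [h9]
  refine norm_proj_sub_le_of_adjacent (γ := γ) (by norm_num) (by norm_num) (norm_apply_le_one hu)
    (fun a => ?_) hmod hγκ (fun l hl => ?_)
    (fun _ _ _ hab hbd => pairKet_contiguous hσ hab hbd) a b
  · by_cases ha : k ≤ (a : ℕ) ∧ (a : ℕ) ≤ k + 1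
    · exact (sq_le_one_iff₀ (norm_nonneg _)).1
        (by rw [norm_pairKet_sq hσ ha.1 ha.2]; norm_num)
    · rw [pairKet_eq_zero σ (by omega) (by omega), norm_zero]; exact zero_le_one
  · rcases eq_or_ne l k with rfl | hlk
    · convert h using 2
      rw [proj_apply (pairKet D l σ), pairKet_left hk, pairKet_right hk]
      have := inv_sqrt_mul_self 2
      simp only [map_mul, map_inv₀, Complex.conj_ofReal]
      push_cast at this
      rw [← mul_assoc, this]
      ring
    · refine (norm_proj_sub_le_of_eq_zero (norm_apply_le_one hu) hmod ?_).trans hγκ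
      rcases lt_or_gt_of_ne hlk with h | h
      · exact Or.inl (pairKet_eq_zero σ (by simpa using hlk) (by simp; omega))
      · exact Or.inr (pairKet_eq_zero σ (by simp; omega) (by simpa using hlk))

theorem tripleKet_eq_zero {k : ℕ} (σ τ : ℂ) {l : Fin D} (h : (l : ℕ) < k ∨ k + 2 < (l : ℕ)) :
    tripleKet D k σ τ l = 0 := by
  have h1 : (l : ℕ) ≠ k := by omega
  have h2 : (l : ℕ) ≠ k + 1 := by omega
  have h3 : (l : ℕ) ≠ k + 2 := by omega
  simp [tripleKet, h1, h2, h3]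

theorem norm_tripleKet_sq {k : ℕ} {σ τ : ℂ} (hσ : ‖σ‖ = 1) (hτ : ‖τ‖ = 1) {l : Fin D}
    (h : k ≤ (l : ℕ)) (h' : (l : ℕ) ≤ k + 2) : ‖tripleKet D k σ τ l‖ ^ 2 = 1 / 3 := by
  have h3 : ‖((Real.sqrt 3)⁻¹ : ℂ)‖ ^ 2 = 1 / 3 := by
    rw [norm_inv, Complex.norm_real, Real.norm_eq_abs, inv_pow, sq_abs,
      Real.sq_sqrt (by norm_num)]
    norm_num
  simp only [tripleKet]
  split_ifs
  · rw [norm_mul, hσ, mul_one, h3]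
  · exact h3
  · rw [norm_mul, hτ, mul_one, h3]
  · omega

theorem tripleKet_contiguous {k : ℕ} {σ τ : ℂ} (hσ : ‖σ‖ = 1) (hτ : ‖τ‖ = 1) {a b d : Fin D}
    (hab : a < b) (hbd : b < d) : 1 / 3 ≤ ‖tripleKet D k σ τ b‖ ^ 2 ∨ tripleKet D k σ τ a = 0 ∨
      tripleKet D k σ τ d = 0 := by
  have hab' : (a : ℕ) < b := hab
  have hbd' : (b : ℕ) < d := hbd
  by_cases hb : k ≤ (b : ℕ) ∧ (b : ℕ) ≤ k + 2
  · left; rw [norm_tripleKet_sq hσ hτ hb.1 hb.2]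
  · right
    rcases lt_or_ge (b : ℕ) k with h | h
    · exact Or.inl (tripleKet_eq_zero σ τ (by omega))
    · exact Or.inr (tripleKet_eq_zero σ τ (by omega))

theorem proj_tripleKet_left {k : ℕ} (hk : k + 2 < D) (σ τ : ℂ) :
    proj (tripleKet D k σ τ) ⟨k, by omega⟩ ⟨k + 1, by omega⟩ = σ / 3 := by
  have := inv_sqrt_mul_self 3
  push_cast at this
  simp only [proj_apply, tripleKet, map_inv₀, Complex.conj_ofReal, if_true, Nat.succ_ne_self,
    if_false]
  linear_combination σ * this

theorem proj_tripleKet_right {k : ℕ} (hk : k + 2 < D) (σ τ : ℂ) :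
    proj (tripleKet D k σ τ) ⟨k + 1, by omega⟩ ⟨k + 2, by omega⟩ = conj τ / 3 := by
  have := inv_sqrt_mul_self 3
  push_cast at this
  simp only [proj_apply, tripleKet]
  simp
  linear_combination conj τ * this

/-- A pure state with populations close to those of `tripleKet D k σ τ` is determined by its two
neighbouring coherences. -/
theorem norm_proj_sub_tripleKet_le {k : ℕ} (hk : k + 2 < D) {σ τ : ℂ} (hσ : ‖σ‖ = 1)
    (hτ : ‖τ‖ = 1) {u : Ket D} {γ κ : ℝ} (hγκ : γ ≤ κ) (hu : ‖u‖ = 1)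
    (hmod : ∀ a, |‖u a‖ - ‖tripleKet D k σ τ a‖| ≤ γ / 2)
    (h : ‖proj u ⟨k, by omega⟩ ⟨k + 1, by omega⟩ - σ / 3‖ ≤ κ)
    (h' : ‖proj u ⟨k + 1, by omega⟩ ⟨k + 2, hk⟩ - conj τ / 3‖ ≤ κ) (a b : Fin D) :
    ‖proj u a b - proj (tripleKet D k σ τ) a b‖ ≤ 9 ^ D * κ := by
  have h9 : (9 : ℝ) = 3 / (1 / 3) := by norm_num
  rw [h9]
  refine norm_proj_sub_le_of_adjacent (γ := γ) (by norm_num) (by norm_num) (norm_apply_le_one hu)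
    (fun a => ?_) hmod hγκ (fun l hl => ?_)
    (fun _ _ _ hab hbd => tripleKet_contiguous hσ hτ hab hbd) a b
  · by_cases ha : k ≤ (a : ℕ) ∧ (a : ℕ) ≤ k + 2
    · exact (sq_le_one_iff₀ (norm_nonneg _)).1
        (by rw [norm_tripleKet_sq hσ hτ ha.1 ha.2]; norm_num)
    · rw [tripleKet_eq_zero σ τ (by omega), norm_zero]; exact zero_le_one
  · rcases eq_or_ne l k with rfl | hlk
    · rw [proj_tripleKet_left hk]; exact h
    rcases eq_or_ne l (k + 1) with rfl | hlk'
    · have e := proj_tripleKet_right hk σ τ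
      rw [show proj (tripleKet D k σ τ) ⟨k + 1, by omega⟩ ⟨k + 1 + 1, hl⟩ = conj τ / 3 from e]
      exact h'
    · refine (norm_proj_sub_le_of_eq_zero (norm_apply_le_one hu) hmod ?_).trans hγκ
      rcases lt_or_gt_of_ne hlk with h | h
      · exact Or.inl (tripleKet_eq_zero σ τ (Or.inl (by simpa using h)))
      · exact Or.inr (tripleKet_eq_zero σ τ (Or.inr (by simp; omega)))

theorem inner_tripleKet {k : ℕ} (hk : k + 2 < D) (σ τ : ℂ) :
    inner ℂ (tripleKet D k 1 1) (tripleKet D k σ τ) = (1 / 3 : ℂ) * (σ + 1 + τ) := by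
  have h3 := inv_sqrt_mul_self 3
  push_cast at h3
  have hsub : ∑ l ∈ ({⟨k, by omega⟩, ⟨k + 1, by omega⟩, ⟨k + 2, hk⟩} : Finset (Fin D)),
      conj (tripleKet D k 1 1 l) * tripleKet D k σ τ l =
      ∑ l, conj (tripleKet D k 1 1 l) * tripleKet D k σ τ l := by
    refine Finset.sum_subset (Finset.subset_univ _) fun l _ hl => ?_
    have h1 : (l : ℕ) ≠ k := fun h => hl (by simp [Fin.ext_iff, h])
    have h2 : (l : ℕ) ≠ k + 1 := fun h => hl (by simp [Fin.ext_iff, h])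
    have h3 : (l : ℕ) ≠ k + 2 := fun h => hl (by simp [Fin.ext_iff, h])
    simp [tripleKet, h1, h2, h3]
  rw [inner_eq_sum, ← hsub, Finset.sum_insert (by simp), Finset.sum_insert (by simp),
    Finset.sum_singleton]
  simp only [tripleKet]
  simp
  linear_combination (σ + 1 + τ) * h3

end Coherences

/-! ### Signs of the imaginary parts -/

section Signs

variable {D : ℕ}

/-- Amplification of the errors when the neighbouring coherences are read off from the overlaps
with the fiducial states. -/
noncomputable def coherenceConst (D : ℕ) : ℝ :=
  (D * 9 ^ D + 2) + (D * 9 ^ D * (2 * (D * 9 ^ D + 2) + 1) + 2)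

theorem one_le_coherenceConst (D : ℕ) : 1 ≤ coherenceConst D := by
  have h : (0 : ℝ) ≤ D * 9 ^ D := by positivity
  have h' : (0 : ℝ) ≤ D * 9 ^ D * (2 * (D * 9 ^ D + 2) + 1) := by positivity
  rw [coherenceConst]; linarith

theorem norm_le_add_of_abs_re_le_of_abs_im_le {w : ℂ} {x y : ℝ} (hx : |w.re| ≤ x) (hy : |w.im| ≤ y) :
    ‖w‖ ≤ x + y :=
  (Complex.norm_le_abs_re_add_abs_im w).trans (add_le_add hx hy)

/-- A complex number of modulus about `1/2` and almost vanishing real part is close to `∓ i/2`. -/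
theorem exists_sign_of_abs_re_le {w : ℂ} {x y : ℝ} (hre : |w.re| ≤ x)
    (hn : |‖w‖ - 1 / 2| ≤ y) :
    ∃ s : ℝ, (s = 1 ∨ s = -1) ∧ ‖w - conj ((s : ℂ) * Complex.I) / 2‖ ≤ 2 * x + y := by
  have h1 := Complex.norm_le_abs_re_add_abs_im w
  have h2 := Complex.abs_im_le_norm w
  have key : |(|w.im| - 1 / 2)| ≤ x + y := by
    rw [abs_le] at hn ⊢
    constructor <;> linarith [(abs_nonneg _).trans hre]
  rcases le_total 0 w.im with h | h
  · refine ⟨-1, Or.inr rfl, (norm_le_add_of_abs_re_le_of_abs_im_le (x := x) (y := x + y) ?_ ?_).trans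
      (by linarith)⟩
    · simpa using hre
    · rw [abs_of_nonneg h] at key
      convert key using 2
      simp
  · refine ⟨1, Or.inl rfl, (norm_le_add_of_abs_re_le_of_abs_im_le (x := x) (y := x + y) ?_ ?_).trans
      (by linarith)⟩
    · simpa using hre
    · rw [abs_of_nonpos h, ← abs_neg] at key
      convert key using 2
      simp; ring

variable {ι : Type*} {z c : ι → Ket D} {γ : ℝ}

/-- For neighbouring levels, the overlaps determine the real parts of the coherences (through the
states `(|k⟩ + |k+1⟩)/√2`, whose own coherence is positive by the choice of phases), and the
imaginary parts up to a sign common to all states (through `(|k⟩ + i|k+1⟩)/√2`). -/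
theorem exists_sign_coherence (hz : ∀ i, ‖z i‖ = 1) (hc : ∀ i, ‖c i‖ = 1)
    (hmod : ∀ i a, |‖z i a‖ - ‖c i a‖| ≤ γ / 2)
    (hov : ∀ i j, |‖inner ℂ (z i) (z j)‖ ^ 2 - ‖inner ℂ (c i) (c j)‖ ^ 2| ≤ γ)
    {k : ℕ} (hk : k + 1 < D) {F G : ι} (hF : c F = pairKet D k 1)
    (hG : c G = pairKet D k Complex.I)
    (hgauge : proj (z F) ⟨k, by omega⟩ ⟨k + 1, hk⟩ =
      (‖proj (z F) ⟨k, by omega⟩ ⟨k + 1, hk⟩‖ : ℂ)) :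
    ∃ s : ℝ, (s = 1 ∨ s = -1) ∧ ∀ i,
      ‖(⟨(proj (z i) ⟨k, by omega⟩ ⟨k + 1, hk⟩).re,
        s * (proj (z i) ⟨k, by omega⟩ ⟨k + 1, hk⟩).im⟩ : ℂ) -
          proj (c i) ⟨k, by omega⟩ ⟨k + 1, hk⟩‖ ≤ coherenceConst D * γ := by
  have hγ : 0 ≤ γ := (abs_nonneg _).trans (hov F F)
  have hnorm : ∀ σ : ℂ, ‖σ‖ = 1 → ∀ i, c i = pairKet D k σ →
      |‖proj (z i) ⟨k, by omega⟩ ⟨k + 1, hk⟩‖ - 1 / 2| ≤ γ := by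
    intro σ hσ i hi
    have h1 := abs_norm_mul_sub_le (norm_apply_le_one (hz i) ⟨k + 1, hk⟩)
      (norm_apply_le_one (hc i) ⟨k, by omega⟩) (hmod i ⟨k, by omega⟩) (hmod i ⟨k + 1, hk⟩)
    have h2 : ‖c i ⟨k, by omega⟩‖ * ‖c i ⟨k + 1, hk⟩‖ = 1 / 2 := by
      rw [hi, pairKet_left hk, pairKet_right hk, norm_mul, hσ, mul_one, ← norm_mul]
      have := inv_sqrt_mul_self 2
      push_cast at this
      rw [this]; norm_num
    rw [h2] at h1
    rwa [proj_apply, norm_mul, RCLike.norm_conj]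
  have hF1 : ∀ a b, ‖proj (z F) a b - proj (pairKet D k 1) a b‖ ≤ 9 ^ D * γ := by
    refine norm_proj_sub_pairKet_le hk (by simp) le_rfl (hz F)
      (fun a => by rw [← hF]; exact hmod F a) ?_
    rw [hgauge]
    have := hnorm 1 (by simp) F hF
    rw [← Real.norm_eq_abs, ← Complex.norm_real] at this
    push_cast at this
    simpa using this
  have hre : ∀ i, |(proj (z i) ⟨k, by omega⟩ ⟨k + 1, hk⟩).re -
      (proj (c i) ⟨k, by omega⟩ ⟨k + 1, hk⟩).re| ≤ (D * 9 ^ D + 2) * γ := by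
    intro i
    have h1 := abs_re_mul_coherence_sub_le hk (σ := 1) (τ := 1) (by simp) (by simp)
      (by positivity : 0 ≤ 9 ^ D * γ) (hz i) (hc i) (hmod i) hF1 (by rw [← hF]; exact hov F i)
    rw [one_mul, one_mul] at h1
    linarith
  have hGre : |(proj (z G) ⟨k, by omega⟩ ⟨k + 1, hk⟩).re| ≤ (D * 9 ^ D + 2) * γ := by
    have h1 := hre G
    have h2 : (proj (c G) ⟨k, by omega⟩ ⟨k + 1, hk⟩).re = 0 := by
      rw [hG, proj_apply, pairKet_left hk, pairKet_right hk]
      simp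
    rwa [h2, sub_zero] at h1
  obtain ⟨s, hs, hsG⟩ := exists_sign_of_abs_re_le hGre (hnorm _ (by simp) G hG)
  have hsn : ‖(s : ℂ) * Complex.I‖ = 1 := by rcases hs with rfl | rfl <;> simp
  refine ⟨s, hs, fun i => ?_⟩
  have hG1 := norm_proj_sub_pairKet_le (κ := (2 * (D * 9 ^ D + 2) + 1) * γ) hk hsn
    (le_mul_of_one_le_left hγ (by
      have : (0 : ℝ) ≤ D * 9 ^ D := by positivity
      linarith)) (hz G) (fun a => by
      have h1 := hmod G a
      have h2 : ‖pairKet D k ((s : ℂ) * Complex.I) a‖ = ‖c G a‖ := by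
        rw [hG]
        simp only [pairKet]
        split_ifs
        · rfl
        · rw [norm_mul _ ((s : ℂ) * _), hsn, norm_mul _ Complex.I, Complex.norm_I]
        · rfl
      rwa [h2]) (hsG.trans (by linarith))
  have him := abs_re_mul_coherence_sub_le hk (τ := Complex.I) hsn (by simp)
      (by positivity : 0 ≤ 9 ^ D * ((2 * (D * 9 ^ D + 2) + 1) * γ)) (hz i) (hc i) (hmod i) hG1
      (by rw [← hG]; exact hov G i)
  have h1 : |s * (proj (z i) ⟨k, by omega⟩ ⟨k + 1, hk⟩).im -
      (proj (c i) ⟨k, by omega⟩ ⟨k + 1, hk⟩).im| ≤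
        (D * 9 ^ D * (2 * (D * 9 ^ D + 2) + 1) + 2) * γ := by
    rw [← abs_neg]
    calc _ = _ := by
          congr 1
          simp only [Complex.mul_re, Complex.mul_im, Complex.ofReal_re, Complex.ofReal_im,
            Complex.I_re, Complex.I_im]
          ring
      _ ≤ _ := him
      _ = _ := by ring
  refine (norm_le_add_of_abs_re_le_of_abs_im_le (x := (D * 9 ^ D + 2) * γ) (hre i) h1).trans (le_of_eq ?_)
  rw [coherenceConst]; ring

/-- The signs of consecutive pairs of levels agree: otherwise the states
`(|k⟩ + |k+1⟩ + |k+2⟩)/√3` and `(i|k⟩ + |k+1⟩ + i|k+2⟩)/√3` would have overlap about `1/9` instead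
of `5/9`. -/
theorem sign_eq_sign_of_overlap {k : ℕ} (hk : k + 2 < D) {zh zl ch cl : Ket D}
    (hzh : ‖zh‖ = 1) (hzl : ‖zl‖ = 1) (hch : ‖ch‖ = 1)
    (hH : ch = tripleKet D k 1 1) (hL : cl = tripleKet D k Complex.I Complex.I)
    (hmodh : ∀ a, |‖zh a‖ - ‖ch a‖| ≤ γ / 2) (hmodl : ∀ a, |‖zl a‖ - ‖cl a‖| ≤ γ / 2)
    (hov : |‖inner ℂ zh zl‖ ^ 2 - ‖inner ℂ ch cl‖ ^ 2| ≤ γ) {κ s t : ℝ} (hγκ : γ ≤ κ)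
    (hs : s = 1 ∨ s = -1) (ht : t = 1 ∨ t = -1)
    (h1 : ‖(⟨(proj zh ⟨k, by omega⟩ ⟨k + 1, by omega⟩).re,
        s * (proj zh ⟨k, by omega⟩ ⟨k + 1, by omega⟩).im⟩ : ℂ) -
          proj ch ⟨k, by omega⟩ ⟨k + 1, by omega⟩‖ ≤ κ)
    (h2 : ‖(⟨(proj zh ⟨k + 1, by omega⟩ ⟨k + 2, hk⟩).re,
        t * (proj zh ⟨k + 1, by omega⟩ ⟨k + 2, hk⟩).im⟩ : ℂ) -
          proj ch ⟨k + 1, by omega⟩ ⟨k + 2, hk⟩‖ ≤ κ)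
    (h3 : ‖(⟨(proj zl ⟨k, by omega⟩ ⟨k + 1, by omega⟩).re,
        s * (proj zl ⟨k, by omega⟩ ⟨k + 1, by omega⟩).im⟩ : ℂ) -
          proj cl ⟨k, by omega⟩ ⟨k + 1, by omega⟩‖ ≤ κ)
    (h4 : ‖(⟨(proj zl ⟨k + 1, by omega⟩ ⟨k + 2, hk⟩).re,
        t * (proj zl ⟨k + 1, by omega⟩ ⟨k + 2, hk⟩).im⟩ : ℂ) -
          proj cl ⟨k + 1, by omega⟩ ⟨k + 2, hk⟩‖ ≤ κ)
    (hsmall : 2 * (D * 9 ^ D * κ) + γ < 4 / 9) : s = t := by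
  have hκ : 0 ≤ κ := by linarith [(abs_nonneg _).trans hov]
  -- undo a sign in the imaginary part
  have unsign : ∀ {r : ℝ}, r = 1 ∨ r = -1 → ∀ {w v : ℂ},
      ‖(⟨w.re, r * w.im⟩ : ℂ) - v‖ ≤ κ → ‖w - ⟨v.re, r * v.im⟩‖ ≤ κ := by
    rintro r (rfl | rfl) w v h
    · simpa using h
    · rw [← Complex.norm_conj]
      convert h using 2
      apply Complex.ext <;> simp
  have I3 : ∀ r : ℝ, (⟨(Complex.I / 3).re, r * (Complex.I / 3).im⟩ : ℂ) = r * Complex.I / 3 := by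
    intro r; apply Complex.ext <;> simp [div_eq_mul_inv]
  have I3' : ∀ r : ℝ, (⟨(conj Complex.I / 3).re, r * (conj Complex.I / 3).im⟩ : ℂ) =
      conj (r * Complex.I) / 3 := by
    intro r; apply Complex.ext <;> simp [div_eq_mul_inv]
  have one3 : ∀ r : ℝ, (⟨((1 : ℂ) / 3).re, r * ((1 : ℂ) / 3).im⟩ : ℂ) = 1 / 3 := by
    intro r; apply Complex.ext <;> simp
  have hsn : ‖(s : ℂ) * Complex.I‖ = 1 := by rcases hs with rfl | rfl <;> simp
  have htn : ‖(t : ℂ) * Complex.I‖ = 1 := by rcases ht with rfl | rfl <;> simp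
  rw [hH, proj_tripleKet_left hk] at h1
  rw [hH, proj_tripleKet_right hk, map_one] at h2
  rw [hL, proj_tripleKet_left hk] at h3
  rw [hL, proj_tripleKet_right hk] at h4
  replace h1 := unsign hs h1
  replace h2 := unsign ht h2
  replace h3 := unsign hs h3
  replace h4 := unsign ht h4
  rw [one3] at h1 h2
  rw [I3] at h3
  rw [I3'] at h4
  have e1 := norm_proj_sub_tripleKet_le hk (σ := 1) (τ := 1) (by simp) (by simp) hγκ hzh
    (fun a => by rw [← hH]; exact hmodh a) h1 (by rw [map_one]; exact h2)
  have e2 := norm_proj_sub_tripleKet_le hk hsn htn hγκ hzl (fun a => by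
      have h1 := hmodl a
      have h2 : ‖tripleKet D k ((s : ℂ) * Complex.I) ((t : ℂ) * Complex.I) a‖ = ‖cl a‖ := by
        rw [hL]
        simp only [tripleKet]
        split_ifs
        · rw [norm_mul _ ((s : ℂ) * _), hsn, norm_mul _ Complex.I, Complex.norm_I]
        · rfl
        · rw [norm_mul _ ((t : ℂ) * _), htn, norm_mul _ Complex.I, Complex.norm_I]
        · rfl
      rwa [h2]) h3 h4
  have o1 := abs_overlap_sub_le (by positivity) hzl e1
  have o2 := abs_overlap_sub_le (by positivity) hch e2
  have n5 : ‖inner ℂ ch cl‖ ^ 2 = 5 / 9 := by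
    rw [hH, hL, inner_tripleKet hk, ← Complex.normSq_eq_norm_sq, Complex.normSq_apply]
    simp; norm_num
  rw [n5] at hov
  by_contra hst
  have hst' : s + t = 0 := by rcases hs with rfl | rfl <;> rcases ht with rfl | rfl <;> simp_all
  have n1 : ‖inner ℂ (tripleKet D k ((s : ℂ) * Complex.I) ((t : ℂ) * Complex.I)) ch‖ ^ 2 =
      1 / 9 := by
    have hst'' : (s : ℂ) + t = 0 := by exact_mod_cast hst'
    rw [norm_inner_symm, hH, inner_tripleKet hk,
      show (s : ℂ) * Complex.I + 1 + t * Complex.I = 1 by linear_combination Complex.I * hst'']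
    norm_num
  rw [n1, norm_inner_symm, hH] at o2
  rw [abs_le] at *
  linarith

/-- Pure states whose populations and overlaps are close to those of a reference family containing
the fiducial states have coherences close to the reference ones, up to a global complex
conjugation, provided the phases of the levels are chosen so that the coherence of
`(|k⟩ + |k+1⟩)/√2` is positive. -/
theorem coherences_close_or_conj_close (hz : ∀ i, ‖z i‖ = 1) (hc : ∀ i, ‖c i‖ = 1)
    (hmod : ∀ i a, |‖z i a‖ - ‖c i a‖| ≤ γ / 2)
    (hov : ∀ i j, |‖inner ℂ (z i) (z j)‖ ^ 2 - ‖inner ℂ (c i) (c j)‖ ^ 2| ≤ γ)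
    {F G H L : ℕ → ι} (hF : ∀ k, k + 1 < D → c (F k) = pairKet D k 1)
    (hG : ∀ k, k + 1 < D → c (G k) = pairKet D k Complex.I)
    (hH : ∀ k, k + 2 < D → c (H k) = tripleKet D k 1 1)
    (hL : ∀ k, k + 2 < D → c (L k) = tripleKet D k Complex.I Complex.I)
    (hgauge : ∀ k (hk : k + 1 < D), proj (z (F k)) ⟨k, by omega⟩ ⟨k + 1, hk⟩ =
      (‖proj (z (F k)) ⟨k, by omega⟩ ⟨k + 1, hk⟩‖ : ℂ))
    {m : ℝ} (hm : 0 < m) (hm1 : m ≤ 1)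
    (hsupp : ∀ i, ∀ a b d : Fin D, a < b → b < d → m ≤ ‖c i b‖ ^ 2 ∨ c i a = 0 ∨ c i d = 0)
    (hsmall : 2 * (D * 9 ^ D * (coherenceConst D * γ)) + γ < 4 / 9) :
    (∀ i a b, ‖proj (z i) a b - proj (c i) a b‖ ≤ (3 / m) ^ D * (coherenceConst D * γ)) ∨
    (∀ i a b, ‖conj (proj (z i) a b) - proj (c i) a b‖ ≤
      (3 / m) ^ D * (coherenceConst D * γ)) := by
  have hex := fun k (hk : k + 1 < D) =>
    exists_sign_coherence hz hc hmod hov hk (hF k hk) (hG k hk) (hgauge k hk)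
  choose! s hs hcoh using hex
  have hγ : ∀ i a, γ ≤ coherenceConst D * γ := fun i a => by
    have := (abs_nonneg _).trans (hmod i a)
    exact le_mul_of_one_le_left (by linarith) (one_le_coherenceConst D)
  have hconst : ∀ k, k + 1 < D → s k = s 0 := by
    intro k
    induction k with
    | zero => intro _; rfl
    | succ k ih =>
      intro hk
      rw [← ih (by omega)]
      exact (sign_eq_sign_of_overlap hk (hz (H k)) (hz (L k)) (hc (H k)) (hH k hk) (hL k hk)
        (hmod _) (hmod _) (hov _ _) (hγ (H k) ⟨k, by omega⟩) (hs k (by omega)) (hs (k + 1) hk)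
        (hcoh k (by omega) _) (hcoh (k + 1) hk _) (hcoh k (by omega) _) (hcoh (k + 1) hk _)
        hsmall).symm
  by_cases h1 : ∀ k, k + 1 < D → s k = 1
  · left
    intro i a b
    refine norm_proj_sub_le_of_adjacent hm hm1 (norm_apply_le_one (hz i))
      (norm_apply_le_one (hc i)) (hmod i) (hγ i a) (fun k hk => ?_) (hsupp i) a b
    have := hcoh k hk i
    rw [h1 k hk] at this
    simpa using this
  · right
    have h2 : ∀ k, k + 1 < D → s k = -1 := by
      push Not at h1
      obtain ⟨l, hl, hl1⟩ := h1
      intro k hk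
      rw [hconst k hk, ← hconst l hl]
      exact (hs l hl).resolve_left hl1
    intro i a b
    set z' : Ket D := WithLp.toLp 2 fun a => conj (z i a) with hz'
    have e : ∀ a b, proj z' a b = conj (proj (z i) a b) := fun a b => by
      simp [proj_apply, hz']
    rw [← e]
    refine norm_proj_sub_le_of_adjacent hm hm1 (fun a => ?_)
      (norm_apply_le_one (hc i)) (fun a => ?_) (hγ i a) (fun k hk => ?_) (hsupp i) a b
    · rw [hz']; simpa using norm_apply_le_one (hz i) a
    · rw [hz']; simpa using hmod i a
    · have := hcoh k hk i
      rw [h2 k hk] at this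
      rw [e]
      convert this using 3
      apply Complex.ext <;> simp

/-- Phases `d_k` making prescribed products `d_k u_k d̄_{k+1}` nonnegative. -/
theorem exists_phases (u : ℕ → ℂ) :
    ∃ d : ℕ → ℂ, (∀ k, ‖d k‖ = 1) ∧ ∀ k, d k * u k * conj (d (k + 1)) = ‖u k‖ := by
  have hp : ∀ k, ∃ p : ℂ, ‖p‖ = 1 ∧ u k * conj p = ‖u k‖ := by
    intro k
    rcases eq_or_ne (u k) 0 with h | h
    · exact ⟨1, by simp, by simp [h]⟩
    · have h' : (‖u k‖ : ℂ) ≠ 0 := by exact_mod_cast norm_ne_zero_iff.2 h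
      refine ⟨u k / ‖u k‖, by simp [h], ?_⟩
      rw [map_div₀, Complex.conj_ofReal, mul_div_assoc', Complex.mul_conj']
      field_simp
  choose p hp1 hp2 using hp
  have hd : ∀ k, ‖∏ j ∈ Finset.range k, p j‖ = 1 := fun k => by
    rw [norm_prod]; exact Finset.prod_eq_one fun j _ => hp1 j
  refine ⟨fun k => ∏ j ∈ Finset.range k, p j, hd, fun k => ?_⟩
  simp only [Finset.prod_range_succ, map_mul]
  have h1 : (∏ j ∈ Finset.range k, p j) * conj (∏ j ∈ Finset.range k, p j) = 1 := by
    rw [Complex.mul_conj', hd]; simp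
  linear_combination ‖u k‖ * h1 + (∏ j ∈ Finset.range k, p j) *
    conj (∏ j ∈ Finset.range k, p j) * hp2 k

/-- The version of `coherences_close_or_conj_close` with the choice of phases included. -/
theorem exists_phases_coherences_close (hz : ∀ i, ‖z i‖ = 1) (hc : ∀ i, ‖c i‖ = 1)
    (hmod : ∀ i a, |‖z i a‖ - ‖c i a‖| ≤ γ / 2)
    (hov : ∀ i j, |‖inner ℂ (z i) (z j)‖ ^ 2 - ‖inner ℂ (c i) (c j)‖ ^ 2| ≤ γ)
    {F G H L : ℕ → ι} (hF : ∀ k, k + 1 < D → c (F k) = pairKet D k 1)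
    (hG : ∀ k, k + 1 < D → c (G k) = pairKet D k Complex.I)
    (hH : ∀ k, k + 2 < D → c (H k) = tripleKet D k 1 1)
    (hL : ∀ k, k + 2 < D → c (L k) = tripleKet D k Complex.I Complex.I)
    {m : ℝ} (hm : 0 < m) (hm1 : m ≤ 1)
    (hsupp : ∀ i, ∀ a b d : Fin D, a < b → b < d → m ≤ ‖c i b‖ ^ 2 ∨ c i a = 0 ∨ c i d = 0)
    (hsmall : 2 * (D * 9 ^ D * (coherenceConst D * γ)) + γ < 4 / 9) :
    ∃ d : Fin D → ℂ, (∀ a, ‖d a‖ = 1) ∧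
    ((∀ i a b, ‖d a * proj (z i) a b * conj (d b) - proj (c i) a b‖ ≤
      (3 / m) ^ D * (coherenceConst D * γ)) ∨
    (∀ i a b, ‖conj (d a * proj (z i) a b * conj (d b)) - proj (c i) a b‖ ≤
      (3 / m) ^ D * (coherenceConst D * γ))) := by
  obtain ⟨d, hd1, hd2⟩ := exists_phases fun k =>
    if hk : k + 1 < D then proj (z (F k)) ⟨k, by omega⟩ ⟨k + 1, hk⟩ else 0
  set z' : ι → Ket D := fun i => WithLp.toLp 2 fun a => d a * z i a with hz'
  have e : ∀ i a b, proj (z' i) a b = d a * proj (z i) a b * conj (d b) := fun i a b => by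
    simp only [proj_apply, hz', map_mul]; ring
  have en : ∀ i a, ‖z' i a‖ = ‖z i a‖ := fun i a => by
    simp only [hz', norm_mul, hd1, one_mul]
  have ei : ∀ i j, inner ℂ (z' i) (z' j) = inner ℂ (z i) (z j) := fun i j => by
    rw [inner_eq_sum, inner_eq_sum]
    refine Finset.sum_congr rfl fun a _ => ?_
    simp only [hz', map_mul]
    have h1 : conj (d a) * d a = 1 := by rw [Complex.conj_mul', hd1]; simp
    linear_combination conj (z i a) * z j a * h1
  have en' : ∀ i, ‖z' i‖ = 1 := fun i => by
    rw [← hz i, EuclideanSpace.norm_eq, EuclideanSpace.norm_eq]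
    simp only [en]
  refine ⟨fun a => d a, fun a => hd1 a, ?_⟩
  simp only [← e]
  refine coherences_close_or_conj_close en' hc (fun i a => by rw [en]; exact hmod i a)
    (fun i j => by rw [ei]; exact hov i j) hF hG hH hL (fun k hk => ?_) hm hm1 hsupp hsmall
  have h1 := hd2 k
  simp only [hk, dif_pos] at h1
  have h2 : proj (z' (F k)) ⟨k, by omega⟩ ⟨k + 1, hk⟩ =
      (‖proj (z (F k)) ⟨k, by omega⟩ ⟨k + 1, hk⟩‖ : ℂ) := by rw [e]; exact h1
  rw [h2]
  simp

end Signs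

/-! ### Rigidity of overlaps -/

section Rigidity

open scoped Matrix.Norms.Frobenius

variable {D : ℕ}

/-- An almost isometric matrix is close to a unitary, its polar factor `B (Bᴴ B)^(-1/2)`. -/
theorem exists_unitary_near {B : Op D} (h : ‖B.conjTranspose * B - 1‖ < 1) :
    ∃ U ∈ Matrix.unitaryGroup (Fin D) ℂ, ‖B - U‖ ≤ ‖B.conjTranspose * B - 1‖ := by
  have hG := Matrix.isHermitian_conjTranspose_mul_self B
  set g := hG.eigenvalues with hg
  set V : Op D := (hG.eigenvectorUnitary : Op D) with hVdef
  have hV : V ∈ Matrix.unitaryGroup (Fin D) ℂ := hG.eigenvectorUnitary.2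
  have hVV : star V * V = 1 := Matrix.mem_unitaryGroup_iff'.1 hV
  have hVV' : V * star V = 1 := Matrix.mem_unitaryGroup_iff.1 hV
  have hspec : B.conjTranspose * B = V * Matrix.diagonal (fun i => (g i : ℂ)) * star V := by
    have h1 := hG.spectral_theorem
    rw [Unitary.conjStarAlgAut_apply] at h1
    exact h1
  have hdiag : B.conjTranspose * B - 1 =
      V * Matrix.diagonal (fun i => ((g i - 1 : ℝ) : ℂ)) * star V := by
    have e : Matrix.diagonal (fun i => ((g i - 1 : ℝ) : ℂ)) =
        Matrix.diagonal (fun i => (g i : ℂ)) - 1 := by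
      rw [← Matrix.diagonal_one, Matrix.diagonal_sub]
      simp
    rw [e, mul_sub, sub_mul, mul_one, hVV', ← hspec]
  have hnorm : ‖B.conjTranspose * B - 1‖ = ‖Matrix.diagonal (fun i => ((g i - 1 : ℝ) : ℂ))‖ := by
    rw [hdiag, frobenius_mul_unitary (Unitary.star_mem hV), frobenius_unitary_mul hV]
  have hpos : ∀ i, 0 < g i := by
    intro i
    have h1 := norm_entry_le_frobenius (Matrix.diagonal (fun i => ((g i - 1 : ℝ) : ℂ))) i i
    rw [← hnorm, Matrix.diagonal_apply_eq, Complex.norm_real, Real.norm_eq_abs] at h1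
    linarith [(abs_lt.1 (h1.trans_lt h)).1]
  have hsq : ∀ i, (Real.sqrt (g i) : ℂ) ≠ 0 := fun i => by
    exact_mod_cast (Real.sqrt_pos.2 (hpos i)).ne'
  set S : Op D := Matrix.diagonal (fun i => ((Real.sqrt (g i))⁻¹ : ℂ)) with hS
  set T : Op D := Matrix.diagonal (fun i => (Real.sqrt (g i) : ℂ)) with hT
  have hST : S * T = 1 := by
    rw [hS, hT, Matrix.diagonal_mul_diagonal, ← Matrix.diagonal_one]
    congr 1; funext i; exact inv_mul_cancel₀ (hsq i)
  have hSGS : S * Matrix.diagonal (fun i => (g i : ℂ)) * S = 1 := by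
    rw [hS, Matrix.diagonal_mul_diagonal, Matrix.diagonal_mul_diagonal, ← Matrix.diagonal_one]
    congr 1; funext i
    have h1 : (g i : ℂ) = Real.sqrt (g i) * Real.sqrt (g i) := by
      exact_mod_cast (Real.mul_self_sqrt (hpos i).le).symm
    have h2 := hsq i
    rw [h1]
    field_simp
  have hSs : star S = S := by
    rw [hS, Matrix.star_eq_conjTranspose, Matrix.diagonal_conjTranspose]
    congr 1; funext i; simp
  have hU : B * V * S * star V ∈ Matrix.unitaryGroup (Fin D) ℂ := by
    rw [Matrix.mem_unitaryGroup_iff']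
    calc star (B * V * S * star V) * (B * V * S * star V)
        = V * (S * (star V * (B.conjTranspose * B) * V) * S) * star V := by
          simp only [star_mul, star_star, hSs, Matrix.star_eq_conjTranspose B, mul_assoc]
      _ = V * (S * (star V * V * Matrix.diagonal (fun i => (g i : ℂ)) * (star V * V)) * S) *
            star V := by
          rw [hspec]; simp only [mul_assoc]
      _ = 1 := by rw [hVV, one_mul, mul_one, hSGS, mul_one, hVV']
  refine ⟨_, hU, ?_⟩
  have hB : B - B * V * S * star V = B * V * S * star V * (V * (T - 1) * star V) := by
    calc B - B * V * S * star V = B * (V * star V) - B * V * S * star V := by rw [hVV', mul_one]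
      _ = B * V * (S * T) * star V - B * V * S * star V := by
          rw [hST, mul_one, mul_assoc B V (star V)]
      _ = B * V * S * (star V * V) * (T - 1) * star V := by
          rw [hVV, mul_one, mul_sub, sub_mul, mul_one, ← mul_assoc]
      _ = _ := by simp only [mul_assoc]
  rw [hB, frobenius_unitary_mul hU, frobenius_mul_unitary (Unitary.star_mem hV),
    frobenius_unitary_mul hV, hnorm, ← sq_le_sq₀ (norm_nonneg _) (norm_nonneg _),
    frobenius_sq_eq_sum, frobenius_sq_eq_sum]
  refine Finset.sum_le_sum fun i _ => Finset.sum_le_sum fun j _ => ?_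
  have hT1 : T - 1 = Matrix.diagonal (fun i => ((Real.sqrt (g i) - 1 : ℝ) : ℂ)) := by
    rw [hT, ← Matrix.diagonal_one, Matrix.diagonal_sub]; simp
  rw [hT1]
  rcases eq_or_ne i j with rfl | hij
  · rw [Matrix.diagonal_apply_eq, Matrix.diagonal_apply_eq, Complex.norm_real, Complex.norm_real,
      Real.norm_eq_abs, Real.norm_eq_abs, sq_abs, sq_abs]
    -- `g - 1 = (√g - 1) (√g + 1)`
    have h1 := Real.sq_sqrt (hpos i).le
    have h2 := Real.sqrt_nonneg (g i)
    have h3 : g i - 1 = (Real.sqrt (g i) - 1) * (Real.sqrt (g i) + 1) := by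
      linear_combination -h1
    rw [h3, mul_pow]
    exact le_mul_of_one_le_right (sq_nonneg _) (one_le_pow₀ (by linarith))
  · rw [Matrix.diagonal_apply_ne _ hij, Matrix.diagonal_apply_ne _ hij]

/-- The matrix with columns `b k`. -/
noncomputable def columns (b : Fin D → Ket D) : Op D := Matrix.of fun a k => b k a

theorem columns_conjTranspose_mul (b : Fin D → Ket D) :
    (columns b).conjTranspose * columns b = Matrix.of fun k l => inner ℂ (b k) (b l) := by
  ext k l
  simp [Matrix.mul_apply, columns, inner_eq_sum]

theorem columns_mem_unitaryGroup (e : OrthonormalBasis (Fin D) ℂ (Ket D)) :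
    columns e ∈ Matrix.unitaryGroup (Fin D) ℂ := by
  rw [Matrix.mem_unitaryGroup_iff', Matrix.star_eq_conjTranspose, columns_conjTranspose_mul]
  ext k l
  rw [Matrix.of_apply, orthonormal_iff_ite.1 e.orthonormal, Matrix.one_apply]

theorem proj_mulVec (A : Op D) (v : Ket D) :
    proj (WithLp.toLp 2 (A.mulVec v.ofLp)) = A * proj v * A.conjTranspose := by
  rw [proj_eq_vecMulVec, proj_eq_vecMulVec, Matrix.mul_vecMulVec, Matrix.vecMulVec_mul]
  congr 1
  rw [Matrix.star_mulVec]

theorem columns_mulVec_repr (e : OrthonormalBasis (Fin D) ℂ (Ket D)) (v : Ket D) :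
    WithLp.toLp 2 ((columns e).mulVec (e.repr v).ofLp) = v := by
  conv_rhs => rw [← e.sum_repr v]
  ext a
  simp [Matrix.mulVec, dotProduct, columns, mul_comm]

theorem proj_eq_columns_conj (e : OrthonormalBasis (Fin D) ℂ (Ket D)) (v : Ket D) :
    proj v = columns e * proj (e.repr v) * (columns e).conjTranspose := by
  rw [← proj_mulVec, columns_mulVec_repr]

theorem abs_sub_le_of_abs_sq_sub_le {x y t : ℝ} (hx : 0 ≤ x) (hy : 0 ≤ y) (ht : 0 ≤ t)
    (h : |x ^ 2 - y ^ 2| ≤ t ^ 2) : |x - y| ≤ t := by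
  refine abs_le_of_sq_le_sq ?_ ht
  calc (x - y) ^ 2 = |x - y| * |x - y| := by rw [abs_mul_abs_self, sq]
    _ ≤ |x - y| * |x + y| := by
        refine mul_le_mul_of_nonneg_left ?_ (abs_nonneg _)
        rw [abs_of_nonneg (add_nonneg hx hy)]
        exact abs_le.2 ⟨by linarith, by linarith⟩
    _ = |x ^ 2 - y ^ 2| := by rw [← abs_mul]; congr 1; ring
    _ ≤ t ^ 2 := h

/-- Passing to nearby pure states preserves approximate overlaps. -/
theorem exists_pure_overlaps_close (hD : 0 < D) {ι : Type*} {Ψ : ι → Ket D}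
    (hΨ : ∀ i, ‖Ψ i‖ = 1) {ρ : ι → Op D} (hρ : ∀ i, IsState (ρ i)) {t : ℝ}
    (h : ∀ i j, |(ρ i * ρ j).trace.re - ‖inner ℂ (Ψ i) (Ψ j)‖ ^ 2| ≤ t ^ 2) :
    ∃ φ : ι → Ket D, (∀ i, ‖φ i‖ = 1) ∧ (∀ i, ‖ρ i - proj (φ i)‖ ≤ 2 * t ^ 2) ∧
      ∀ i j, |‖inner ℂ (φ i) (φ j)‖ ^ 2 - ‖inner ℂ (Ψ i) (Ψ j)‖ ^ 2| ≤ 5 * t ^ 2 := by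
  have hex : ∀ i, ∃ φ : Ket D, ‖φ‖ = 1 ∧ ‖ρ i - proj φ‖ ≤ 2 * t ^ 2 := by
    intro i
    refine (hρ i).exists_pure_near hD ?_
    have h1 := h i i
    rw [inner_self_eq_norm_sq_to_K, hΨ i] at h1
    simp only [RCLike.ofReal_one, one_pow, norm_one] at h1
    linarith [(abs_le.1 h1).1]
  choose φ hφ hφ' using hex
  refine ⟨φ, hφ, hφ', fun i j => ?_⟩
  have e : ((‖inner ℂ (φ i) (φ j)‖ ^ 2 : ℝ) : ℂ) - (ρ i * ρ j).trace =
      -((ρ i - proj (φ i)) * proj (φ j)).trace - (ρ i * (ρ j - proj (φ j))).trace := by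
    rw [← trace_proj_mul_proj, Matrix.sub_mul, Matrix.mul_sub, Matrix.trace_sub, Matrix.trace_sub]
    ring
  have b1 : ‖((ρ i - proj (φ i)) * proj (φ j)).trace‖ ≤ 2 * t ^ 2 * 1 :=
    (norm_trace_mul_le _ _).trans (mul_le_mul (hφ' i) (isState_proj (hφ j)).frobenius_le_one
      (norm_nonneg _) (by positivity))
  have b2 : ‖(ρ i * (ρ j - proj (φ j))).trace‖ ≤ 1 * (2 * t ^ 2) :=
    (norm_trace_mul_le _ _).trans (mul_le_mul (hρ i).frobenius_le_one (hφ' j)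
      (norm_nonneg _) zero_le_one)
  have b3 : |‖inner ℂ (φ i) (φ j)‖ ^ 2 - (ρ i * ρ j).trace.re| ≤ 4 * t ^ 2 := by
    have h2 := congrArg Complex.re e
    rw [Complex.sub_re, Complex.ofReal_re] at h2
    rw [h2]
    refine (Complex.abs_re_le_norm _).trans ((norm_sub_le _ _).trans ?_)
    rw [norm_neg]; linarith
  have b4 := h i j
  rw [abs_le] at *
  constructor <;> linarith

/-- Kets whose overlaps are close to those of a family containing an orthonormal basis have, in
suitable coordinates, approximately the right populations. -/
theorem exists_unitary_populations_close {ι : Type*} {Ψ φ : ι → Ket D}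
    (hφ : ∀ i, ‖φ i‖ = 1) {t : ℝ} (ht : 0 ≤ t) (htD : D * (3 * t) < 1)
    (h : ∀ i j, |‖inner ℂ (φ i) (φ j)‖ ^ 2 - ‖inner ℂ (Ψ i) (Ψ j)‖ ^ 2| ≤ 5 * t ^ 2)
    (e : OrthonormalBasis (Fin D) ℂ (Ket D)) (he : ∀ k, ∃ i, Ψ i = e k) :
    ∃ U ∈ Matrix.unitaryGroup (Fin D) ℂ, ∀ i k,
      |‖(U.conjTranspose.mulVec (φ i).ofLp) k‖ - ‖e.repr (Ψ i) k‖| ≤ (3 * D ^ 2 + 3) * t := by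
  choose B hB using he
  have hmod : ∀ i j, |‖inner ℂ (φ i) (φ j)‖ - ‖inner ℂ (Ψ i) (Ψ j)‖| ≤ 3 * t := fun i j =>
    abs_sub_le_of_abs_sq_sub_le (norm_nonneg _) (norm_nonneg _) (by positivity)
      ((h i j).trans (by nlinarith [sq_nonneg t]))
  set b := columns fun k => φ (B k) with hb
  have hbb : ‖b.conjTranspose * b - 1‖ ≤ D * (3 * t) := by
    refine frobenius_le_of_entry_le (by positivity) fun k l => ?_
    rw [hb, columns_conjTranspose_mul, Matrix.sub_apply, Matrix.of_apply]
    rcases eq_or_ne k l with rfl | hkl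
    · rw [inner_self_eq_norm_sq_to_K, hφ]
      simp [ht]
    · have h1 := hmod (B k) (B l)
      rw [hB, hB, orthonormal_iff_ite.1 e.orthonormal, if_neg hkl, norm_zero, sub_zero,
        abs_norm] at h1
      rwa [Matrix.one_apply_ne hkl, sub_zero]
  obtain ⟨U, hU, hUb⟩ := exists_unitary_near (hbb.trans_lt htD)
  refine ⟨U, hU, fun i k => ?_⟩
  have h1 := hmod (B k) i
  rw [hB, ← e.repr_apply_apply] at h1
  have h2 : ‖(U.conjTranspose.mulVec (φ i).ofLp) k - inner ℂ (φ (B k)) (φ i)‖ ≤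
      D * (D * (3 * t)) := by
    have e1 : (U.conjTranspose.mulVec (φ i).ofLp) k - inner ℂ (φ (B k)) (φ i) =
        ∑ a, -conj ((b - U) a k) * φ i a := by
      rw [inner_eq_sum, Matrix.mulVec, dotProduct, ← Finset.sum_sub_distrib]
      refine Finset.sum_congr rfl fun a _ => ?_
      simp [hb, columns, sub_mul]
    rw [e1]
    refine (norm_sum_le _ _).trans ?_
    calc ∑ a, ‖-conj ((b - U) a k) * φ i a‖ ≤ ∑ _a : Fin D, D * (3 * t) := by
          refine Finset.sum_le_sum fun a _ => ?_
          rw [norm_mul, norm_neg, RCLike.norm_conj]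
          calc ‖(b - U) a k‖ * ‖φ i a‖ ≤ D * (3 * t) * 1 :=
                mul_le_mul (((norm_entry_le_frobenius _ _ _).trans hUb).trans hbb)
                  (norm_apply_le_one (hφ i) a) (norm_nonneg _) (by positivity)
            _ = _ := mul_one _
      _ = D * (D * (3 * t)) := by simp
  have h3 := (abs_norm_sub_norm_le _ _).trans h2
  rw [abs_le] at *
  constructor <;> nlinarith

/-- Composing a unitary, phases and an orthonormal basis to a unitary or anti-unitary. -/
theorem exists_isUnitaryOrAntiunitary_close {ι : Type*} {Ψ φ : ι → Ket D}
    (e : OrthonormalBasis (Fin D) ℂ (Ket D)) {U : Op D}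
    (hU : U ∈ Matrix.unitaryGroup (Fin D) ℂ) {d : Fin D → ℂ} (hd : ∀ a, ‖d a‖ = 1) {κ : ℝ}
    (hκ : 0 ≤ κ)
    (h : (∀ i a b, ‖d a * proj (WithLp.toLp 2 (U.conjTranspose.mulVec (φ i).ofLp)) a b *
        conj (d b) - proj (e.repr (Ψ i)) a b‖ ≤ κ) ∨
      (∀ i a b, ‖conj (d a * proj (WithLp.toLp 2 (U.conjTranspose.mulVec (φ i).ofLp)) a b *
        conj (d b)) - proj (e.repr (Ψ i)) a b‖ ≤ κ)) :
    ∃ Θ : Op D → Op D, IsUnitaryOrAntiunitary Θ ∧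
      ∀ i, ‖Θ (proj (φ i)) - proj (Ψ i)‖ ≤ D * κ := by
  have hE := columns_mem_unitaryGroup e
  have hΔ : Matrix.diagonal d ∈ Matrix.unitaryGroup (Fin D) ℂ := by
    rw [Matrix.mem_unitaryGroup_iff, Matrix.star_eq_conjTranspose, Matrix.diagonal_conjTranspose,
      Matrix.diagonal_mul_diagonal, ← Matrix.diagonal_one]
    congr 1; funext a
    simp [Complex.mul_conj', hd]
  have hQ : Matrix.diagonal d * star U ∈ Matrix.unitaryGroup (Fin D) ℂ :=
    mul_mem hΔ (Unitary.star_mem hU)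
  have hentry : ∀ i a b, (Matrix.diagonal d * star U * proj (φ i) *
      (Matrix.diagonal d * star U).conjTranspose) a b =
      d a * proj (WithLp.toLp 2 (U.conjTranspose.mulVec (φ i).ofLp)) a b * conj (d b) := by
    intro i a b
    rw [proj_mulVec, Matrix.conjTranspose_mul, Matrix.star_eq_conjTranspose,
      Matrix.diagonal_conjTranspose, ← mul_assoc, Matrix.mul_diagonal, mul_assoc (Matrix.diagonal d),
      mul_assoc (Matrix.diagonal d), Matrix.diagonal_mul]
    simp
  rcases h with h | h
  · refine ⟨fun A => (columns e * (Matrix.diagonal d * star U)) * A *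
      (columns e * (Matrix.diagonal d * star U)).conjTranspose,
      ⟨_, mul_mem hE hQ, Or.inl fun _ => rfl⟩, fun i => ?_⟩
    have e1 : (columns e * (Matrix.diagonal d * star U)) * proj (φ i) *
        (columns e * (Matrix.diagonal d * star U)).conjTranspose - proj (Ψ i) =
        columns e * (Matrix.diagonal d * star U * proj (φ i) *
          (Matrix.diagonal d * star U).conjTranspose - proj (e.repr (Ψ i))) *
            (columns e).conjTranspose := by
      rw [proj_eq_columns_conj e (Ψ i), Matrix.conjTranspose_mul (columns e)]
      noncomm_ring
    rw [e1, frobenius_conj_unitary hE]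
    refine frobenius_le_of_entry_le hκ fun a b => ?_
    rw [Matrix.sub_apply, hentry]
    exact h i a b
  · have hQ' : (Matrix.diagonal d * star U).map (starRingEnd ℂ) ∈
        Matrix.unitaryGroup (Fin D) ℂ := by
      rw [Matrix.mem_unitaryGroup_iff] at hQ ⊢
      have h1 : star ((Matrix.diagonal d * star U).map (starRingEnd ℂ)) =
          (star (Matrix.diagonal d * star U)).map (starRingEnd ℂ) := by
        ext a b; simp only [Matrix.star_apply, Matrix.map_apply]; rfl
      rw [h1, ← Matrix.map_mul, hQ, Matrix.map_one _ (map_zero _) (map_one _)]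
    refine ⟨fun A => (columns e * (Matrix.diagonal d * star U).map (starRingEnd ℂ)) *
      A.map (starRingEnd ℂ) *
      (columns e * (Matrix.diagonal d * star U).map (starRingEnd ℂ)).conjTranspose,
      ⟨_, mul_mem hE hQ', Or.inr fun _ => rfl⟩, fun i => ?_⟩
    have e2 : ((Matrix.diagonal d * star U).map (starRingEnd ℂ)).conjTranspose =
        ((Matrix.diagonal d * star U).conjTranspose).map (starRingEnd ℂ) := by
      ext a b; simp only [Matrix.conjTranspose_apply, Matrix.map_apply]; rfl
    have e1 : (columns e * (Matrix.diagonal d * star U).map (starRingEnd ℂ)) *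
        (proj (φ i)).map (starRingEnd ℂ) *
        (columns e * (Matrix.diagonal d * star U).map (starRingEnd ℂ)).conjTranspose -
          proj (Ψ i) =
        columns e * ((Matrix.diagonal d * star U * proj (φ i) *
          (Matrix.diagonal d * star U).conjTranspose).map (starRingEnd ℂ) -
            proj (e.repr (Ψ i))) * (columns e).conjTranspose := by
      rw [proj_eq_columns_conj e (Ψ i), Matrix.conjTranspose_mul (columns e), e2]
      simp only [Matrix.map_mul]
      noncomm_ring
    rw [e1, frobenius_conj_unitary hE]
    refine frobenius_le_of_entry_le hκ fun a b => ?_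
    rw [Matrix.sub_apply, Matrix.map_apply, hentry]
    exact h i a b

/-- Rigidity: states whose pairwise overlaps are within `t²` of those of a reference family of pure
states containing the fiducial states are within `O(t)` of them, up to one common unitary or
anti-unitary. -/
theorem exists_rigidity (hD : 0 < D) {m : ℝ} (hm : 0 < m) (hm1 : m ≤ 1) :
    ∃ C t₀ : ℝ, 0 < C ∧ 0 < t₀ ∧ ∀ (ι : Type) (Ψ : ι → Ket D) (ρ : ι → Op D)
      (e : OrthonormalBasis (Fin D) ℂ (Ket D)) (t : ℝ), (∀ i, ‖Ψ i‖ = 1) →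
      (∀ i, IsState (ρ i)) → (∀ k, ∃ i, Ψ i = e k) →
      (∀ k, k + 1 < D → ∃ i, e.repr (Ψ i) = pairKet D k 1) →
      (∀ k, k + 1 < D → ∃ i, e.repr (Ψ i) = pairKet D k Complex.I) →
      (∀ k, k + 2 < D → ∃ i, e.repr (Ψ i) = tripleKet D k 1 1) →
      (∀ k, k + 2 < D → ∃ i, e.repr (Ψ i) = tripleKet D k Complex.I Complex.I) →
      (∀ i, ∀ a b d : Fin D, a < b → b < d →
        m ≤ ‖e.repr (Ψ i) b‖ ^ 2 ∨ e.repr (Ψ i) a = 0 ∨ e.repr (Ψ i) d = 0) →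
      0 ≤ t → t ≤ t₀ →
      (∀ i j, |(ρ i * ρ j).trace.re - ‖inner ℂ (Ψ i) (Ψ j)‖ ^ 2| ≤ t ^ 2) →
      ∃ Θ : Op D → Op D, IsUnitaryOrAntiunitary Θ ∧
        ∀ i, traceNorm (Θ (ρ i) - proj (Ψ i)) ≤ C * t := by
  -- `γ = g t` bounds the errors of populations and overlaps
  set g : ℝ := 2 * (3 * D ^ 2 + 3) with hg
  have hg0 : 0 < g := by positivity
  have hcc := one_le_coherenceConst D
  set A : ℝ := 2 * (D * 9 ^ D * (coherenceConst D * g)) + g with hA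
  have hA0 : 0 < A := by
    have : (0 : ℝ) ≤ 2 * (D * 9 ^ D * (coherenceConst D * g)) := by positivity
    linarith
  have hD1 : (1 : ℝ) ≤ D := by exact_mod_cast hD
  set t₀ : ℝ := min (1 / (4 * D)) (1 / (3 * A)) with ht₀
  set C₁ : ℝ := (3 / m) ^ D * (coherenceConst D * g) with hC₁
  have hC₁0 : 0 < C₁ := by positivity
  refine ⟨D * (2 + D * C₁), t₀, by positivity, lt_min (by positivity) (by positivity), ?_⟩
  intro ι Ψ ρ e t hΨ hρ he hF hG hH hL hsupp ht0 ht h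
  have ht1 : t ≤ 1 / (4 * D) := ht.trans (min_le_left _ _)
  have ht2 : t ≤ 1 / (3 * A) := ht.trans (min_le_right _ _)
  rw [le_div_iff₀ (by positivity)] at ht1 ht2
  have htle1 : t ≤ 1 := by nlinarith
  have : Nonempty ι := ⟨(he ⟨0, hD⟩).choose⟩
  choose! F hF using hF
  choose! G hG using hG
  choose! H hH using hH
  choose! L hL using hL
  obtain ⟨φ, hφ, hρφ, hov⟩ := exists_pure_overlaps_close hD hΨ hρ h
  obtain ⟨U, hU, hpop⟩ := exists_unitary_populations_close hφ ht0 (by nlinarith) hov e he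
  set z : ι → Ket D := fun i => WithLp.toLp 2 (U.conjTranspose.mulVec (φ i).ofLp) with hz
  have hzz : ∀ i j, ‖inner ℂ (z i) (z j)‖ ^ 2 = ‖inner ℂ (φ i) (φ j)‖ ^ 2 := by
    intro i j
    have h1 := trace_proj_mul_proj (z i) (z j)
    have hUU : U * U.conjTranspose = 1 := Matrix.mem_unitaryGroup_iff.1 hU
    rw [hz, proj_mulVec, proj_mulVec, Matrix.conjTranspose_conjTranspose,
      show U.conjTranspose * proj (φ i) * U * (U.conjTranspose * proj (φ j) * U) =
        U.conjTranspose * (proj (φ i) * (U * U.conjTranspose) * proj (φ j) * U) by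
          simp only [mul_assoc], hUU, mul_one, Matrix.trace_mul_comm, mul_assoc, hUU, mul_one,
      trace_proj_mul_proj] at h1
    exact_mod_cast h1.symm
  have hznorm : ∀ i, ‖z i‖ = 1 := by
    intro i
    have h1 := hzz i i
    rw [inner_self_eq_norm_sq_to_K, inner_self_eq_norm_sq_to_K, hφ] at h1
    simp only [RCLike.ofReal_one, one_pow, norm_one, norm_pow, RCLike.norm_ofReal, abs_norm] at h1
    have h2 : (‖z i‖ ^ 2) ^ 2 = 1 := h1
    exact (pow_eq_one_iff_of_nonneg (norm_nonneg _) (by norm_num : (4 : ℕ) ≠ 0)).1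
      (by rw [← h2]; ring)
  obtain ⟨d, hd, hclose⟩ := exists_phases_coherences_close (γ := g * t) hznorm
    (c := fun i => e.repr (Ψ i)) (fun i => by rw [LinearIsometryEquiv.norm_map, hΨ])
    (fun i a => (hpop i a).trans (by rw [hg]; linarith))
    (fun i j => by
      rw [hzz, LinearIsometryEquiv.inner_map_map]
      refine (hov i j).trans ?_
      have hg6 : 6 ≤ g := by rw [hg]; nlinarith [sq_nonneg (D : ℝ)]
      nlinarith)
    hF hG hH hL hm hm1 hsupp (by
      have : 2 * (D * 9 ^ D * (coherenceConst D * (g * t))) + g * t = A * t := by rw [hA]; ring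
      rw [this]
      linarith)
  obtain ⟨Θ, hΘ, hΘ'⟩ := exists_isUnitaryOrAntiunitary_close (Ψ := Ψ) (φ := φ) e hU hd
    (κ := (3 / m) ^ D * (coherenceConst D * (g * t))) (by positivity) hclose
  refine ⟨Θ, hΘ, fun i => (traceNorm_le_frobenius _).trans ?_⟩
  rw [mul_assoc]
  refine mul_le_mul_of_nonneg_left ?_ (by positivity)
  calc ‖Θ (ρ i) - proj (Ψ i)‖ = ‖(Θ (ρ i) - Θ (proj (φ i))) + (Θ (proj (φ i)) - proj (Ψ i))‖ := by
        rw [sub_add_sub_cancel]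
    _ ≤ 2 * t ^ 2 + D * ((3 / m) ^ D * (coherenceConst D * (g * t))) :=
        (norm_add_le _ _).trans (add_le_add (by rw [hΘ.frobenius_sub]; exact hρφ i) (hΘ' i))
    _ ≤ (2 + D * C₁) * t := by
        have h1 : t ^ 2 ≤ t := by nlinarith
        rw [hC₁]
        linarith

end Rigidity

/-! ### The fiducial states -/

section Fiducial

variable {D : ℕ} (e : OrthonormalBasis (Fin D) ℂ (Ket D))

theorem repr_pair {k : ℕ} (hk : k + 1 < D) (σ : ℂ) :
    e.repr ((1 / ((Real.sqrt 2 : ℝ) : ℂ)) • (e ⟨k, by omega⟩ + σ • e ⟨k + 1, hk⟩)) =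
      pairKet D k σ := by
  ext l
  simp only [map_smul, map_add, e.repr_self, PiLp.smul_apply, PiLp.add_apply,
    PiLp.single_apply, smul_eq_mul, pairKet, one_div, Fin.ext_iff]
  split_ifs with h1 h2 <;> first | omega | simp

theorem repr_triple {k : ℕ} (hk : k + 2 < D) (σ τ : ℂ) :
    e.repr ((1 / ((Real.sqrt 3 : ℝ) : ℂ)) •
      (σ • e ⟨k, by omega⟩ + e ⟨k + 1, by omega⟩ + τ • e ⟨k + 2, hk⟩)) = tripleKet D k σ τ := by
  ext l
  simp only [map_smul, map_add, e.repr_self, PiLp.smul_apply, PiLp.add_apply,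
    PiLp.single_apply, smul_eq_mul, tripleKet, one_div, Fin.ext_iff]
  split_ifs with h1 h2 <;> first | omega | simp

/-- The fiducial states, in coordinates with respect to the basis. -/
theorem fiducial_cases (i : Fin (fiducialCount D)) :
    (∃ k, fiducial e i = e k) ∨
    (∃ k, k + 1 < D ∧ e.repr (fiducial e i) = pairKet D k 1) ∨
    (∃ k, k + 1 < D ∧ e.repr (fiducial e i) = pairKet D k Complex.I) ∨
    (∃ k, k + 2 < D ∧ e.repr (fiducial e i) = tripleKet D k 1 1) ∨
    (∃ k, k + 2 < D ∧ e.repr (fiducial e i) = tripleKet D k Complex.I Complex.I) := by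
  induction i using Fin.addCases with
  | right k =>
    refine Or.inr (Or.inr (Or.inr (Or.inr ⟨k, by omega, ?_⟩)))
    rw [fiducial, Fin.append_right, repr_triple e (by omega)]
  | left i =>
  induction i using Fin.addCases with
  | right k =>
    refine Or.inr (Or.inr (Or.inr (Or.inl ⟨k, by omega, ?_⟩)))
    have := repr_triple e (k := k) (by omega) 1 1
    rw [one_smul, one_smul] at this
    rw [fiducial, Fin.append_left, Fin.append_right, this]
  | left i =>
  induction i using Fin.addCases with
  | right k =>
    refine Or.inr (Or.inr (Or.inl ⟨k, by omega, ?_⟩))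
    rw [fiducial, Fin.append_left, Fin.append_left, Fin.append_right, repr_pair e (by omega)]
  | left i =>
  induction i using Fin.addCases with
  | right k =>
    refine Or.inr (Or.inl ⟨k, by omega, ?_⟩)
    have := repr_pair e (k := k) (by omega) 1
    rw [one_smul] at this
    rw [fiducial, Fin.append_left, Fin.append_left, Fin.append_left, Fin.append_right, this]
  | left k =>
    refine Or.inl ⟨k, ?_⟩
    rw [fiducial, Fin.append_left, Fin.append_left, Fin.append_left, Fin.append_left]

theorem exists_fiducial_basis (k : Fin D) : ∃ i, fiducial e i = e k :=
  ⟨Fin.castAdd _ (Fin.castAdd _ (Fin.castAdd _ (Fin.castAdd _ k))), by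
    rw [fiducial, Fin.append_left, Fin.append_left, Fin.append_left, Fin.append_left]⟩

theorem exists_fiducial_pair_one (k : ℕ) (hk : k + 1 < D) :
    ∃ i, e.repr (fiducial e i) = pairKet D k 1 :=
  ⟨Fin.castAdd _ (Fin.castAdd _ (Fin.castAdd _ (Fin.natAdd _ ⟨k, by omega⟩))), by
    have := repr_pair e hk 1
    rw [one_smul] at this
    rw [fiducial, Fin.append_left, Fin.append_left, Fin.append_left, Fin.append_right, this]⟩

theorem exists_fiducial_pair_I (k : ℕ) (hk : k + 1 < D) :
    ∃ i, e.repr (fiducial e i) = pairKet D k Complex.I :=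
  ⟨Fin.castAdd _ (Fin.castAdd _ (Fin.natAdd _ ⟨k, by omega⟩)), by
    rw [fiducial, Fin.append_left, Fin.append_left, Fin.append_right, repr_pair e hk]⟩

theorem exists_fiducial_triple_one (k : ℕ) (hk : k + 2 < D) :
    ∃ i, e.repr (fiducial e i) = tripleKet D k 1 1 :=
  ⟨Fin.castAdd _ (Fin.natAdd _ ⟨k, by omega⟩), by
    have := repr_triple e hk 1 1
    rw [one_smul, one_smul] at this
    rw [fiducial, Fin.append_left, Fin.append_right, this]⟩

theorem exists_fiducial_triple_I (k : ℕ) (hk : k + 2 < D) :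
    ∃ i, e.repr (fiducial e i) = tripleKet D k Complex.I Complex.I :=
  ⟨Fin.natAdd _ ⟨k, by omega⟩, by
    rw [fiducial, Fin.append_right, repr_triple e hk]⟩

theorem norm_pairKet {k : ℕ} (hk : k + 1 < D) {σ : ℂ} (hσ : ‖σ‖ = 1) :
    ‖pairKet D k σ‖ = 1 := by
  have h : ‖pairKet D k σ‖ ^ 2 = 1 := by
    rw [EuclideanSpace.norm_sq_eq, Fintype.sum_eq_add (⟨k, by omega⟩ : Fin D) ⟨k + 1, hk⟩ (by simp),
      norm_pairKet_sq hσ (by simp) (by simp), norm_pairKet_sq hσ (by simp) (by simp)]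
    · norm_num
    · rintro x ⟨h1, h2⟩
      rw [pairKet_eq_zero σ (fun h => h1 (Fin.ext h)) (fun h => h2 (Fin.ext h))]
      simp
  exact (pow_eq_one_iff_of_nonneg (norm_nonneg _) two_ne_zero).1 h

theorem norm_tripleKet {k : ℕ} (hk : k + 2 < D) {σ τ : ℂ} (hσ : ‖σ‖ = 1) (hτ : ‖τ‖ = 1) :
    ‖tripleKet D k σ τ‖ = 1 := by
  have h : ‖tripleKet D k σ τ‖ ^ 2 = 1 := by
    have hsub : ∑ l ∈ ({⟨k, by omega⟩, ⟨k + 1, by omega⟩, ⟨k + 2, hk⟩} : Finset (Fin D)),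
        ‖tripleKet D k σ τ l‖ ^ 2 = ∑ l, ‖tripleKet D k σ τ l‖ ^ 2 := by
      refine Finset.sum_subset (Finset.subset_univ _) fun l _ hl => ?_
      have h1 : (l : ℕ) ≠ k := fun h => hl (by simp [Fin.ext_iff, h])
      have h2 : (l : ℕ) ≠ k + 1 := fun h => hl (by simp [Fin.ext_iff, h])
      have h3 : (l : ℕ) ≠ k + 2 := fun h => hl (by simp [Fin.ext_iff, h])
      rw [tripleKet_eq_zero σ τ (by omega), norm_zero]; norm_num
    rw [EuclideanSpace.norm_sq_eq, ← hsub, Finset.sum_insert (by simp),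
      Finset.sum_insert (by simp), Finset.sum_singleton,
      norm_tripleKet_sq hσ hτ (by simp) (by simp), norm_tripleKet_sq hσ hτ (by simp) (by simp),
      norm_tripleKet_sq hσ hτ (by simp) (by simp)]
    norm_num
  exact (pow_eq_one_iff_of_nonneg (norm_nonneg _) two_ne_zero).1 h

theorem norm_fiducial (i : Fin (fiducialCount D)) : ‖fiducial e i‖ = 1 := by
  rw [← LinearIsometryEquiv.norm_map e.repr]
  rcases fiducial_cases e i with ⟨k, h⟩ | ⟨k, hk, h⟩ | ⟨k, hk, h⟩ | ⟨k, hk, h⟩ | ⟨k, hk, h⟩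
  · rw [h, LinearIsometryEquiv.norm_map, e.orthonormal.1]
  · rw [h, norm_pairKet hk (by simp)]
  · rw [h, norm_pairKet hk (by simp)]
  · rw [h, norm_tripleKet hk (by simp) (by simp)]
  · rw [h, norm_tripleKet hk (by simp) (by simp)]

/-- Each fiducial state occupies an interval of levels, with populations at least `1/3`. -/
theorem fiducial_contiguous (i : Fin (fiducialCount D)) {a b d : Fin D} (hab : a < b)
    (hbd : b < d) : 1 / 3 ≤ ‖e.repr (fiducial e i) b‖ ^ 2 ∨ e.repr (fiducial e i) a = 0 ∨
      e.repr (fiducial e i) d = 0 := by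
  rcases fiducial_cases e i with ⟨k, h⟩ | ⟨k, hk, h⟩ | ⟨k, hk, h⟩ | ⟨k, hk, h⟩ | ⟨k, hk, h⟩
  · right
    rw [h, e.repr_self, PiLp.single_apply, PiLp.single_apply]
    rcases eq_or_ne a k with rfl | hak
    · right; rw [if_neg (hab.trans hbd).ne']
    · left; rw [if_neg hak]
  · rw [h]; exact pairKet_contiguous (by simp) hab hbd
  · rw [h]; exact pairKet_contiguous (by simp) hab hbd
  · rw [h]; exact tripleKet_contiguous (by simp) (by simp) hab hbd
  · rw [h]; exact tripleKet_contiguous (by simp) (by simp) hab hbd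

variable {M : ℕ} (ψ : Fin M → Ket D)

theorem norm_tested {ψ : Fin M → Ket D} (hψ : ∀ i, ‖ψ i‖ = 1) (i : Fin (M + fiducialCount D)) :
    ‖tested ψ e i‖ = 1 := by
  induction i using Fin.addCases with
  | left i => rw [tested, Fin.append_left, hψ]
  | right i => rw [tested, Fin.append_right, norm_fiducial]

theorem norm_extended {K : ℕ} {ψ : Fin M → Ket D} {R : Fin K → Ket D} (hψ : ∀ i, ‖ψ i‖ = 1)
    (hR : ∀ i, ‖R i‖ = 1) (i : Fin (M + fiducialCount D + K)) : ‖extended ψ e R i‖ = 1 := by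
  induction i using Fin.addCases with
  | left i => rw [extended, Fin.append_left, norm_tested e hψ]
  | right i => rw [extended, Fin.append_right, hR]

theorem exists_tested {p : Ket D → Prop} (h : ∃ i, p (fiducial e i)) : ∃ i, p (tested ψ e i) := by
  obtain ⟨i, hi⟩ := h
  exact ⟨Fin.natAdd _ i, by rwa [tested, Fin.append_right]⟩

theorem tested_contiguous {ψ : Fin M → Ket D} {f : ℝ}
    (hf : ∀ i k, f ≤ ‖inner ℂ (e k) (ψ i)‖ ^ 2) (i : Fin (M + fiducialCount D)) (a b d : Fin D)
    (hab : a < b) (hbd : b < d) : min f (1 / 3) ≤ ‖e.repr (tested ψ e i) b‖ ^ 2 ∨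
      e.repr (tested ψ e i) a = 0 ∨ e.repr (tested ψ e i) d = 0 := by
  induction i using Fin.addCases with
  | left i =>
    left
    rw [tested, Fin.append_left, e.repr_apply_apply]
    exact (min_le_left _ _).trans (hf i b)
  | right i =>
    rw [tested, Fin.append_right]
    rcases fiducial_contiguous e i hab hbd with h | h
    · exact Or.inl ((min_le_right _ _).trans h)
    · exact Or.inr h

end Fiducial

/-! ### Robust self-testing -/

section Robust

open scoped Matrix.Norms.Frobenius

variable {D : ℕ}

theorem isUnitaryOrAntiunitary_id : IsUnitaryOrAntiunitary (id : Op D → Op D) :=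
  ⟨1, one_mem _, Or.inl fun A => by simp⟩

theorem traceNorm_sub_le_of_isState {ρ σ : Op D} (hρ : IsState ρ) (hσ : IsState σ) :
    traceNorm (ρ - σ) ≤ 2 * D := by
  refine (traceNorm_le_frobenius _).trans ?_
  have h := (norm_sub_le ρ σ).trans (add_le_add hρ.frobenius_le_one hσ.frobenius_le_one)
  have hD : (0 : ℝ) ≤ D := by positivity
  nlinarith

/-- The witness robustly self-tests with error of order `ε^(1/4)`; the weaker exponents follow
since only `ε ≤ 1` matters. -/
theorem exists_robust_const (hD : 0 < D) {f a r : ℝ} (hf : 0 < f) (ha : 0 < a) (hr : 0 < r)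
    (hr4 : r ≤ 1 / 4) : ∃ C : ℝ, 0 < C ∧
      ∀ (M K : ℕ) (ψ : Fin M → Ket D) (e : OrthonormalBasis (Fin D) ℂ (Ket D))
        (R : Fin K → Ket D) (α : Fin (M + fiducialCount D + K) → ℝ),
        (∀ i, ‖ψ i‖ = 1) → (∀ i, ‖R i‖ = 1) →
        (∀ i k, f ≤ ‖inner ℂ (e k) (ψ i)‖ ^ 2) →
        ResolvesIdentity (extended ψ e R) α → (∀ i, a ≤ α i) →
        RobustlySelfTestsStates (witness (extended ψ e R) α) (1 - 1 / (D : ℝ)) (Fin.castAdd K)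
          (fun i => proj (tested ψ e i)) C r := by
  obtain ⟨C₀, t₀, hC₀, ht₀, hrig⟩ := exists_rigidity (m := min f (1 / 3)) hD
    (lt_min hf (by norm_num)) ((min_le_right _ _).trans (by norm_num))
  have hD1 : (1 : ℝ) ≤ D := by exact_mod_cast hD
  -- overlaps are within `c √ε` of the reference ones, and states within `C₀ √c ε^(1/4)`
  set c : ℝ := 2 / a + 2 / a ^ 2 with hc
  have hc0 : 0 < c := by positivity
  have hsc : 0 < Real.sqrt c := Real.sqrt_pos.2 hc0
  -- below the threshold `ε₀` rigidity applies, above it the bound is trivial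
  set x₀ : ℝ := min 1 (t₀ / Real.sqrt c) with hx₀
  have hx₀0 : 0 < x₀ := lt_min one_pos (by positivity)
  have hx₀1 : x₀ ≤ 1 := min_le_left _ _
  refine ⟨C₀ * Real.sqrt c + 2 * D / x₀, by positivity, ?_⟩
  intro M K ψ e R α hψ hR hov hres haα ε hε ρ E P hreal hW
  have hst : ∀ i, IsState (ρ i) := hreal.state
  rcases le_or_gt (ε ^ (1 / 4 : ℝ)) x₀ with hx | hx
  · set x : ℝ := ε ^ (1 / 4 : ℝ) with hxdef
    have hx0 : 0 ≤ x := Real.rpow_nonneg hε _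
    have hx4 : (x ^ 2) ^ 2 = ε := by
      rw [← pow_mul, hxdef, ← Real.rpow_natCast, ← Real.rpow_mul hε]; norm_num
    have hε1 : ε ≤ 1 := by
      rw [← hx4]; exact pow_le_one₀ (sq_nonneg _) (pow_le_one₀ hx0 (hx.trans hx₀1))
    have hxr : x ≤ ε ^ r := by
      rcases hε.eq_or_lt with h0 | h0
      · rw [hxdef, ← h0, Real.zero_rpow (by norm_num), Real.zero_rpow hr.ne']
      · exact Real.rpow_le_rpow_of_exponent_ge h0 hε1 hr4
    have hq := abs_trace_sub_overlap_le hD (norm_extended e hψ hR) hres ha haα hreal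
      (sq_nonneg x) (pow_le_one₀ hx0 (hx.trans hx₀1)) (by rw [hx4]; exact hW)
    obtain ⟨Θ, hΘ, hΘ'⟩ := hrig (Fin (M + fiducialCount D)) (tested ψ e)
      (fun i => ρ (Fin.castAdd K i)) e (Real.sqrt c * x) (norm_tested e hψ) (fun i => hst _)
      (fun k => exists_tested e ψ (p := fun v => v = _) (exists_fiducial_basis e k))
      (fun k hk => exists_tested e ψ (p := fun v => e.repr v = _) (exists_fiducial_pair_one e k hk))
      (fun k hk => exists_tested e ψ (p := fun v => e.repr v = _) (exists_fiducial_pair_I e k hk))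
      (fun k hk => exists_tested e ψ (p := fun v => e.repr v = _)
        (exists_fiducial_triple_one e k hk))
      (fun k hk => exists_tested e ψ (p := fun v => e.repr v = _) (exists_fiducial_triple_I e k hk))
      (tested_contiguous e hov) (by positivity) (by
        have := hx.trans (min_le_right _ _)
        rw [le_div_iff₀ hsc] at this
        linarith) (fun i j => by
        have := hq (Fin.castAdd K i) (Fin.castAdd K j)
        rw [extended, Fin.append_left, Fin.append_left] at this
        rwa [mul_pow, Real.sq_sqrt hc0.le])
    refine ⟨Θ, hΘ, fun i => (hΘ' i).trans ?_⟩
    calc C₀ * (Real.sqrt c * x) = C₀ * Real.sqrt c * x := by ring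
      _ ≤ (C₀ * Real.sqrt c + 2 * D / x₀) * ε ^ r := by
        have : 0 ≤ 2 * D / x₀ := by positivity
        exact mul_le_mul (by linarith) hxr hx0 (by positivity)
  · refine ⟨id, isUnitaryOrAntiunitary_id, fun i => ?_⟩
    refine (traceNorm_sub_le_of_isState (hst _) (isState_proj (norm_tested e hψ i))).trans ?_
    have hxr : x₀ ≤ ε ^ r := by
      rcases le_or_gt ε 1 with h1 | h1
      · rcases hε.eq_or_lt with h0 | h0
        · rw [← h0, Real.zero_rpow (by norm_num)] at hx
          exact absurd hx hx₀0.not_gt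
        · exact hx.le.trans (Real.rpow_le_rpow_of_exponent_ge h0 h1 hr4)
      · exact hx₀1.trans (Real.one_le_rpow h1.le hr.le)
    calc (2 : ℝ) * D = 2 * D / x₀ * x₀ := by field_simp
      _ ≤ (C₀ * Real.sqrt c + 2 * D / x₀) * ε ^ r := by
        have : 0 ≤ C₀ * Real.sqrt c := by positivity
        exact mul_le_mul (by linarith) hxr hx₀0.le (by positivity)

theorem IsUnitaryOrAntiunitary.exists_leftInverse {Θ : Op D → Op D}
    (h : IsUnitaryOrAntiunitary Θ) :
    ∃ Θ' : Op D → Op D, IsUnitaryOrAntiunitary Θ' ∧ ∀ A, Θ' (Θ A) = A := by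
  obtain ⟨U, hU, h⟩ := h
  have hUU : U.conjTranspose * U = 1 := Matrix.mem_unitaryGroup_iff'.1 hU
  rcases h with h | h
  · refine ⟨fun A => star U * A * (star U).conjTranspose,
      ⟨star U, Unitary.star_mem hU, Or.inl fun _ => rfl⟩, fun A => ?_⟩
    simp only [h, Matrix.star_eq_conjTranspose, Matrix.conjTranspose_conjTranspose]
    calc U.conjTranspose * (U * A * U.conjTranspose) * U =
        U.conjTranspose * U * A * (U.conjTranspose * U) := by simp only [mul_assoc]
      _ = A := by rw [hUU, one_mul, mul_one]
  · -- `(U K)⁻¹ = K U† = Uᵀ K`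
    have hmap : ∀ A : Op D, (A.map (starRingEnd ℂ)).map (starRingEnd ℂ) = A := fun A => by
      ext; simp
    have hT : (U.conjTranspose).map (starRingEnd ℂ) = U.transpose := by
      ext; simp
    have hT' : U.map (starRingEnd ℂ) = U.transpose.conjTranspose := by
      ext; simp
    have hTT : U.transpose * U.transpose.conjTranspose = 1 := by
      rw [← hT', ← hT, ← Matrix.map_mul, hUU, Matrix.map_one _ (map_zero _) (map_one _)]
    refine ⟨fun A => U.transpose * A.map (starRingEnd ℂ) * U.transpose.conjTranspose,
      ⟨U.transpose, Matrix.mem_unitaryGroup_iff.2 hTT, Or.inr fun _ => rfl⟩, fun A => ?_⟩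
    simp only [h, Matrix.map_mul, hmap, hT, hT']
    calc _ = U.transpose * U.transpose.conjTranspose * A *
          (U.transpose * U.transpose.conjTranspose) := by simp only [mul_assoc]
      _ = A := by rw [hTT, one_mul, mul_one]

/-- Robust self-testing with a positive exponent implies self-testing, by taking `ε = 0`. -/
theorem RobustlySelfTestsStates.selfTestsStates {X Y B ι : Type} [Fintype B]
    {W : (X → Y → B → ℝ) →ₗ[ℝ] ℝ} {w : ℝ} {s : ι → X} {ψ : ι → Op D} {C r : ℝ} (hr : r ≠ 0)
    (h : RobustlySelfTestsStates W w s ψ C r) (hw : w ∈ W '' behaviours D X Y B) :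
    SelfTestsStates W s ψ := by
  intro ρ E P hreal hmax
  obtain ⟨P', hP', rfl⟩ := hw
  obtain ⟨Θ, hΘ, hΘ'⟩ := h 0 le_rfl ρ E P hreal (by rw [sub_zero]; exact hmax P' hP')
  obtain ⟨Θ', h1, h2⟩ := hΘ.exists_leftInverse
  refine ⟨Θ', h1, fun i => ?_⟩
  have h3 := hΘ' i
  rw [Real.zero_rpow hr, mul_zero] at h3
  rw [← sub_eq_zero.1 (traceNorm_eq_zero h3), h2]

end Robust

/-! ### Adapted bases and completion states -/

section Completion

variable {D : ℕ}

/-- Finitely many nonzero polynomials have a common real non-zero. -/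
theorem exists_real_eval_ne_zero {σ ι : Type*} [Fintype ι] (p : ι → MvPolynomial σ ℂ)
    (hp : ∀ i, p i ≠ 0) :
    ∃ v : σ → ℝ, ∀ i, MvPolynomial.eval (fun j => (v j : ℂ)) (p i) ≠ 0 := by
  by_contra! h
  have h0 : ∏ i, p i = 0 := by
    refine MvPolynomial.funext_set (fun _ => Set.range ((↑) : ℝ → ℂ))
      (fun _ => Set.infinite_range_of_injective Complex.ofReal_injective) fun x hx => ?_
    choose v hv using fun j => hx j (Set.mem_univ j)
    obtain ⟨i, hi⟩ := h v
    rw [map_prod, map_zero]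
    refine Finset.prod_eq_zero (Finset.mem_univ i) ?_
    rw [← hi]
    congr 2
    funext j
    exact (hv j).symm
  obtain ⟨i, -, hi⟩ := Finset.prod_eq_zero_iff.1 h0
  exact hp i hi

/-- The `k`-th component of the reflection of `ψ` in the real line spanned by `X`, cleared of its
denominator. -/
noncomputable def reflectedComponent (ψ : Ket D) (k : Fin D) : MvPolynomial (Fin D) ℂ :=
  2 * (∑ j, MvPolynomial.C (ψ j) * MvPolynomial.X j) * MvPolynomial.X k -
    MvPolynomial.C (ψ k) * ∑ j, MvPolynomial.X j ^ 2

theorem eval_reflectedComponent (ψ : Ket D) (k : Fin D) (v : Fin D → ℂ) :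
    MvPolynomial.eval v (reflectedComponent ψ k) =
      2 * (∑ j, ψ j * v j) * v k - ψ k * ∑ j, v j ^ 2 := by
  simp [reflectedComponent]

theorem reflectedComponent_ne_zero (hD : 2 ≤ D) {ψ : Ket D} (hψ : ψ ≠ 0) (k : Fin D) :
    reflectedComponent ψ k ≠ 0 := by
  intro h0
  have hev : ∀ v : Fin D → ℂ, 2 * (∑ j, ψ j * v j) * v k - ψ k * ∑ j, v j ^ 2 = 0 := fun v => by
    rw [← eval_reflectedComponent, h0, map_zero]
  by_cases hk : ψ k = 0
  · obtain ⟨j, hj⟩ : ∃ j, ψ j ≠ 0 := by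
      by_contra! h
      exact hψ (by ext j; simpa using h j)
    have hjk : k ≠ j := by rintro rfl; exact hj hk
    have h1 := hev (Pi.single j 1 + Pi.single k 1)
    simp [hk, mul_add, Finset.sum_add_distrib, Pi.single_apply, hjk] at h1
    exact hj h1
  · have : Nontrivial (Fin D) := Fin.nontrivial_iff_two_le.2 hD
    obtain ⟨j, hj⟩ := exists_ne k
    have h1 := hev (Pi.single j 1)
    simp [Pi.single_apply, hj.symm] at h1
    exact hk h1

/-- A generic real Householder reflection of the computational basis has no basis vector orthogonal
to one of the given kets. -/
theorem exists_basis_inner_ne_zero (hD : 2 ≤ D) {M : ℕ} (ψ : Fin M → Ket D)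
    (hψ : ∀ i, ψ i ≠ 0) :
    ∃ e : OrthonormalBasis (Fin D) ℂ (Ket D), ∀ i k, inner ℂ (e k) (ψ i) ≠ 0 := by
  obtain ⟨v, hv⟩ := exists_real_eval_ne_zero
    (fun q : Fin M × Fin D => reflectedComponent (ψ q.1) q.2)
    (fun q => reflectedComponent_ne_zero hD (hψ q.1) q.2)
  set u : Ket D := WithLp.toLp 2 fun j => (v j : ℂ) with hu
  refine ⟨(EuclideanSpace.basisFun (Fin D) ℂ).map (Submodule.reflection (ℂ ∙ u)), fun i k h => ?_⟩
  have h1 := hv (i, k)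
  rw [eval_reflectedComponent] at h1
  have h2 : inner ℂ (((EuclideanSpace.basisFun (Fin D) ℂ).map (Submodule.reflection (ℂ ∙ u))) k)
      (ψ i) = (Submodule.reflection (ℂ ∙ u) (ψ i)) k := by
    rw [OrthonormalBasis.map_apply, ← Submodule.reflection_reflection (ℂ ∙ u) (ψ i),
      LinearIsometryEquiv.inner_map_map, Submodule.reflection_reflection, inner_eq_sum]
    simp [PiLp.single_apply]
  have hn : ((‖u‖ : ℂ)) ^ 2 = ∑ j, (v j : ℂ) ^ 2 := by
    have h3 := EuclideanSpace.norm_sq_eq u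
    simp only [hu, Complex.norm_real, Real.norm_eq_abs, sq_abs] at h3
    exact_mod_cast h3
  have hin : inner ℂ u (ψ i) = ∑ j, ψ i j * (v j : ℂ) := by
    rw [inner_eq_sum]
    exact Finset.sum_congr rfl fun j _ => by simp [hu, mul_comm]
  have hu0 : ((‖u‖ : ℂ)) ^ 2 ≠ 0 := by
    intro h0
    have h3 : u = 0 := by simpa using h0
    have h4 : ∀ j, (v j : ℂ) = 0 := fun j => by
      have := congrArg (fun w : Ket D => w j) h3
      simpa [hu] using this
    exact h1 (by simp [h4])
  rw [h2, Submodule.reflection_singleton_apply, PiLp.sub_apply, PiLp.smul_apply, PiLp.smul_apply,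
    hin] at h
  have hu0' := hu0
  rw [hn] at hu0'
  apply h1
  have h5 : u k = (v k : ℂ) := rfl
  have h6 : ((‖u‖ : ℝ) : ℂ) ^ 2 = ∑ j, (v j : ℂ) ^ 2 := hn
  simp only [RCLike.ofReal_eq_complex_ofReal, h6, h5, smul_eq_mul, nsmul_eq_mul,
    Nat.cast_ofNat] at h
  field_simp at h
  linear_combination h

theorem sum_eigenvalue_smul_proj {A : Op D} (hA : A.IsHermitian) :
    ∑ j, (hA.eigenvalues j : ℂ) • proj (hA.eigenvectorBasis j) = A := by
  have h1 := hA.spectral_theorem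
  rw [Unitary.conjStarAlgAut_apply] at h1
  refine Eq.trans ?_ h1.symm
  ext a b
  rw [Matrix.mul_apply, Matrix.sum_apply]
  refine Finset.sum_congr rfl fun j _ => ?_
  rw [Matrix.mul_diagonal, Matrix.star_apply, Matrix.IsHermitian.eigenvectorUnitary_apply,
    Matrix.IsHermitian.eigenvectorUnitary_apply, Matrix.smul_apply, proj_apply]
  simp only [Function.comp_apply, smul_eq_mul, RCLike.star_def, RCLike.ofReal_eq_complex_ofReal]
  ring

theorem sum_proj_orthonormalBasis (e : OrthonormalBasis (Fin D) ℂ (Ket D)) :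
    ∑ j, proj (e j) = 1 := by
  have h := Matrix.mem_unitaryGroup_iff.1 (columns_mem_unitaryGroup e)
  rw [← h]
  ext a b
  rw [Matrix.mul_apply, Matrix.sum_apply]
  rfl

/-- Any nonempty family of pure states is completed by at most `D - 1` further ones to a weighted
resolution of the identity: with `λ` the largest eigenvalue of `A = ∑ Ψ_i`, the operator `λ 𝕀 - A`
is positive of rank less than `D`, and its spectral decomposition gives the completion. -/
theorem exists_completion (hD : 0 < D) {n : ℕ} (hn : 0 < n) (Ψ : Fin n → Ket D)
    (hΨ : ∀ i, ‖Ψ i‖ = 1) :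
    ∃ (K : ℕ) (R : Fin K → Ket D) (α : Fin (n + K) → ℝ),
      K ≤ D - 1 ∧ (∀ i, ‖R i‖ = 1) ∧ ResolvesIdentity (Fin.append Ψ R) α := by
  set A : Op D := ∑ i, proj (Ψ i) with hAdef
  have hA : A.IsHermitian := by
    rw [Matrix.IsHermitian, hAdef, Matrix.conjTranspose_sum]
    simp only [proj_conjTranspose]
  have : Nonempty (Fin D) := ⟨⟨0, hD⟩⟩
  obtain ⟨i₀, hi₀⟩ := Finite.exists_max hA.eigenvalues
  set lam := hA.eigenvalues i₀ with hlam
  have htr : ∑ j, hA.eigenvalues j = n := by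
    have h0 : A.trace = n := by simp [hAdef, Matrix.trace_sum, trace_proj _ (hΨ _)]
    have h1 := congrArg Complex.re (h0.symm.trans hA.trace_eq_sum_eigenvalues)
    simp only [Complex.natCast_re, Complex.re_sum] at h1
    rw [h1]; rfl
  have hlam0 : 0 < lam := by
    by_contra! h0
    have h1 : ∑ j, hA.eigenvalues j ≤ 0 := Finset.sum_nonpos fun j _ => (hi₀ j).trans h0
    rw [htr] at h1
    have h2 : (0 : ℝ) < n := by exact_mod_cast hn
    linarith
  have hD0 : (0 : ℝ) < D := by exact_mod_cast hD
  set eq := (Fintype.equivFin {j // hA.eigenvalues j < lam}).symm with heq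
  refine ⟨Fintype.card {j // hA.eigenvalues j < lam}, fun k => hA.eigenvectorBasis (eq k).1,
    Fin.append (fun _ => 1 / (D * lam)) (fun k => (lam - hA.eigenvalues (eq k).1) / (D * lam)),
    ?_, fun i => hA.eigenvectorBasis.orthonormal.1 _, fun i => ?_, ?_⟩
  · have h1 := Fintype.card_subtype_lt (p := fun j => hA.eigenvalues j < lam) (x := i₀)
      (lt_irrefl _)
    rw [Fintype.card_fin] at h1
    omega
  · induction i using Fin.addCases with
    | left i => rw [Fin.append_left]; positivity
    | right k =>
      rw [Fin.append_right]
      exact div_pos (sub_pos.2 (eq k).2) (by positivity)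
  · rw [Fin.sum_univ_add]
    simp only [Fin.append_left, Fin.append_right]
    rw [← Finset.smul_sum, ← hAdef]
    have h1 : ∑ k, (((lam - hA.eigenvalues (eq k).1) / (D * lam) : ℝ) : ℂ) •
        proj (hA.eigenvectorBasis (eq k).1) =
        ∑ j, (((lam - hA.eigenvalues j) / (D * lam) : ℝ) : ℂ) •
          proj (hA.eigenvectorBasis j) := by
      rw [Equiv.sum_comp eq (fun j => (((lam - hA.eigenvalues j.1) / (D * lam) : ℝ) : ℂ) •
          proj (hA.eigenvectorBasis j.1)),
        ← Finset.sum_subtype (Finset.univ.filter fun j => hA.eigenvalues j < lam) (by simp)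
          (fun j => (((lam - hA.eigenvalues j) / (D * lam) : ℝ) : ℂ) •
            proj (hA.eigenvectorBasis j))]
      refine Finset.sum_subset (Finset.subset_univ _) fun j _ hj => ?_
      have h2 : hA.eigenvalues j = lam :=
        le_antisymm (hi₀ j) (not_lt.1 fun h => hj (by simp [h]))
      rw [h2]; simp
    rw [h1]
    have h3 : ∀ j, (((lam - hA.eigenvalues j) / (D * lam) : ℝ) : ℂ) •
        proj (hA.eigenvectorBasis j) = (1 / (D : ℂ)) • proj (hA.eigenvectorBasis j) -
          ((1 / (D * lam) : ℝ) : ℂ) • ((hA.eigenvalues j : ℂ) • proj (hA.eigenvectorBasis j)) := by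
      intro j
      rw [smul_smul, ← sub_smul]
      congr 1
      have hD' : (D : ℂ) ≠ 0 := by exact_mod_cast hD.ne'
      have hl' : (lam : ℂ) ≠ 0 := by exact_mod_cast hlam0.ne'
      push_cast
      field_simp
    simp only [h3]
    rw [Finset.sum_sub_distrib, ← Finset.smul_sum, ← Finset.smul_sum,
      sum_eigenvalue_smul_proj hA, sum_proj_orthonormalBasis, add_sub_cancel]

end Completion
end SelfTest

open SelfTest in
theorem mainTheorem1 (D : ℕ) (hD : 2 ≤ D) :
    -- an adapted basis and completion states exist
    (∀ (M : ℕ) (ψ : Fin M → Ket D), (∀ i, ‖ψ i‖ = 1) →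
      (∃ e : OrthonormalBasis (Fin D) ℂ (Ket D), ∀ i k, inner ℂ (e k) (ψ i) ≠ 0) ∧
      (∀ e : OrthonormalBasis (Fin D) ℂ (Ket D),
        ∃ (K : ℕ) (R : Fin K → Ket D) (α : Fin (M + fiducialCount D + K) → ℝ),
          K ≤ D - 1 ∧ (∀ i, ‖R i‖ = 1) ∧ ResolvesIdentity (extended ψ e R) α)) ∧
    -- for each such choice, the witness has maximum `1 - 1 / D` and self-tests the states
    (∀ (M K : ℕ) (ψ : Fin M → Ket D) (e : OrthonormalBasis (Fin D) ℂ (Ket D))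
      (R : Fin K → Ket D) (α : Fin (M + fiducialCount D + K) → ℝ),
      (∀ i, ‖ψ i‖ = 1) → (∀ i, ‖R i‖ = 1) →
      (∀ i k, inner ℂ (e k) (ψ i) ≠ 0) →
      ResolvesIdentity (extended ψ e R) α →
      IsGreatest (witness (extended ψ e R) α ''
        behaviours D (Fin (M + fiducialCount D + K)) (PairLabel (M + fiducialCount D + K)) (Fin 2))
        (1 - 1 / (D : ℝ)) ∧
      SelfTestsStates (witness (extended ψ e R) α) (Fin.castAdd K)
        (fun i => proj (tested ψ e i))) ∧
    -- robustness, with a constant depending only on `D` and lower bounds on overlaps and weights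
    (∀ f a : ℝ, 0 < f → 0 < a → ∃ C : ℝ, 0 < C ∧
      ∀ (M K : ℕ) (ψ : Fin M → Ket D) (e : OrthonormalBasis (Fin D) ℂ (Ket D))
        (R : Fin K → Ket D) (α : Fin (M + fiducialCount D + K) → ℝ),
        (∀ i, ‖ψ i‖ = 1) → (∀ i, ‖R i‖ = 1) →
        (∀ i k, f ≤ ‖inner ℂ (e k) (ψ i)‖ ^ 2) →
        ResolvesIdentity (extended ψ e R) α → (∀ i, a ≤ α i) →
        RobustlySelfTestsStates (witness (extended ψ e R) α) (1 - 1 / (D : ℝ)) (Fin.castAdd K)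
          (fun i => proj (tested ψ e i)) C (if D = 2 then 1 / 8 else 1 / 16)) := by
  have hD0 : 0 < D := by omega
  refine ⟨fun M ψ hψ => ⟨exists_basis_inner_ne_zero hD ψ fun i h => ?_, fun e => ?_⟩,
    fun M K ψ e R α hψ hR hne hres => ?_, fun f a hf ha => ?_⟩
  · have h1 := hψ i
    rw [h, norm_zero] at h1
    exact zero_ne_one h1
  · exact exists_completion hD0 (by simp only [fiducialCount]; omega) (tested ψ e)
      (norm_tested e hψ)
  · have hmax := isGreatest_witness hD0 (norm_extended e hψ hR) hres
    refine ⟨hmax, ?_⟩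
    -- the finitely many overlaps and weights are bounded below
    obtain ⟨f, hf, hf'⟩ : ∃ f : ℝ, 0 < f ∧ ∀ q : Fin M × Fin D,
        f ≤ ‖inner ℂ (e q.2) (ψ q.1)‖ ^ 2 := by
      rcases isEmpty_or_nonempty (Fin M × Fin D) with h | h
      · exact ⟨1, one_pos, fun q => h.elim q⟩
      · obtain ⟨q, hq⟩ := Finite.exists_min fun q : Fin M × Fin D =>
          ‖inner ℂ (e q.2) (ψ q.1)‖ ^ 2
        exact ⟨_, pow_pos (norm_pos_iff.2 (hne q.1 q.2)) 2, hq⟩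
    obtain ⟨a, ha, ha'⟩ : ∃ a : ℝ, 0 < a ∧ ∀ i, a ≤ α i := by
      rcases isEmpty_or_nonempty (Fin (M + fiducialCount D + K)) with h | h
      · exact ⟨1, one_pos, fun q => h.elim q⟩
      · obtain ⟨i, hi⟩ := Finite.exists_min α
        exact ⟨α i, hres.1 i, hi⟩
    obtain ⟨C, -, hC⟩ := exists_robust_const (r := 1 / 4) hD0 hf ha (by norm_num) le_rfl
    exact (hC M K ψ e R α hψ hR (fun i k => hf' (i, k)) hres ha').selfTestsStates (by norm_num)
      hmax.1
  · exact exists_robust_const hD0 hf ha (by split_ifs <;> norm_num) (by split_ifs <;> norm_num)
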